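/- Let $(R,\mathfrak m)$ be a regular local ring with field of fractions $K$. A \emph{local quadratic transform} of a local domain $(A,\mathfrak n)$ with field of fractions $K$ is a ring of the form $A[\mathfrak n/x]_{\mathfrak p}$, where $x\in\mathfrak n\setminus\mathfrak n^2$ and $\mathfrak p$ is a prime ideal of $A[\mathfrak n/x]\subseteq K$ containing $\mathfrak n$. Let $R=R_0\subseteq R_1\subseteq R_2\subseteq\cdots$ be an infinite sequence of local rings $(R_n,\mathfrak m_n)$ such that $R_{n+1}$ is a local quadratic transform of $R_n$ for every $n\ge 0$. Assume that the sequence \emph{switches strongly infinitely often}, that is, there do not exist an integer $j\ge 0$ and a height one prime ideal $\mathfrak p$ of $R_j$ such that $\bigcup_{n\ge 0}R_n\subseteq (R_j)_{\mathfrak p}$. Then $V=\bigcup_{n\ge 0}R_n$ is a valuation ring of $K$ of rank one (i.e. of Krull dimension $1$), and so there is a real-valued valuation of $K$ whose valuation ring is $V$. Moreover, if $v: K^\times\to\mathbb R$ is any (additive) valuation with valuation ring $V$, then for all nonzero $f,g\in\mathfrak m$, $$\frac{v(f)}{v(g)}=\lim_{n\to\infty}\frac{\operatorname{ord}_{R_n}(f)}{\operatorname{ord}_{R_n}(g)},$$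 where $\operatorname{ord}_{R_n}(h)$, for $0\ne h\in R_n$, is the integer $r$ with $h\in\mathfrak m_n^{\,r}\setminus\mathfrak m_n^{\,r+1}$. -/

import Mathlib

open IsLocalRing Filter Topology

noncomputable section

namespace QuadraticTransform

variable {K : Type*} [Field K]

/-- The ring `A[𝔪/x]` inside the field `K`, where `𝔪` is the maximal ideal of the local
subring `A`: the subring of `K` generated by `A` and the fractions `y / x` with `y ∈ 𝔪`. -/
def chart (A : LocalSubring K) (x : A.toSubring) : Subring K :=
  Subring.closure
    ((A.toSubring : Set K) ∪ {z | ∃ y ∈ maximalIdeal A.toSubring, z = (y : K) / (x : K)})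

theorem le_chart (A : LocalSubring K) (x : A.toSubring) : A.toSubring ≤ chart A x :=
  fun _ ha => Subring.subset_closure (Or.inl ha)

/-- `B` is a local quadratic transform of `A`: there are `x ∈ 𝔪 \ 𝔪²` and a prime ideal `P` of
`A[𝔪/x]` containing `𝔪` such that `B` is the localization of `A[𝔪/x]` at `P`. -/
def IsLocalQuadraticTransform (A B : LocalSubring K) : Prop :=
  ∃ x ∈ maximalIdeal A.toSubring, x ∉ maximalIdeal A.toSubring ^ 2 ∧
    ∃ (P : Ideal (chart A x)) (_ : P.IsPrime),
      (maximalIdeal A.toSubring).map (Subring.inclusion (le_chart A x)) ≤ P ∧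
      B = LocalSubring.ofPrime (chart A x) P

/-- The sequence `R₀, R₁, …` switches strongly infinitely often: there are no index `j` and
height one prime ideal `p` of `R_j` such that all `R_n` are contained in the localization
`(R_j)_p`. -/
def SwitchesStronglyInfinitelyOften (R : ℕ → LocalSubring K) : Prop :=
  ¬ ∃ (j : ℕ) (p : Ideal (R j).toSubring) (_ : p.IsPrime), p.height = 1 ∧
      ∀ n, (R n).toSubring ≤ (LocalSubring.ofPrime (R j).toSubring p).toSubring

/-- The order of an element `f` of `A` (for `A` Noetherian and `f ≠ 0`): the largest `r` with
`f ∈ 𝔪 ^ r`. (The value is `0` by convention if `f = 0` or `f ∉ A`.) -/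
def ord (A : LocalSubring K) (f : K) : ℕ :=
  sSup {r : ℕ | ∃ a ∈ maximalIdeal A.toSubring ^ r, (a : K) = f}

/-- The real-valued (additive) valuation `v` of `K` is associated to `V`: its valuation ring
`{z | 0 ≤ v z}` is `V`. -/
def IsAssociated (v : AddValuation K (WithTop ℝ)) (V : ValuationSubring K) : Prop :=
  ∀ z : K, z ∈ V ↔ 0 ≤ v z

end QuadraticTransform

end

/-! The associated graded ring of a regular local ring is a polynomial ring over the residue field
(`coeff_mem_of_sum_mem_pow_succ`). Hence `ord` is additive on products, and `A[𝔪/x]/(x)` is again a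
polynomial ring (`IsParameterSystem.exists_chart_hom`), so quadratic transforms stay regular.
Moreover the order of a strict transform `f / x ^ ord f` never exceeds that of `f`: its image in the
polynomial ring is nonzero of degree at most `ord f`, and degree bounds the order at any prime
(`eq_zero_of_mul_mem_pow_of_totalDegree_lt`).

Elements whose iterated strict transforms reach a unit (`EventuallyUnit`) form a saturated
multiplicative set in each `R j`, and every later ring lies in the localization of `R j` at this
set. A height one prime avoiding the set would contradict strong switching. So every height one
prime meets it, and looking at the minimal primes of `(b)` shows that every nonzero `b` is
eventually a unit (`SwitchesStronglyInfinitelyOften.eventuallyUnit`).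

This gives the valuation ring: in `z = a / b`, strip common powers of `x n` from both entries. The
minimum of the two orders is non-increasing, hence stabilizes, and from then on one entry undergoes
plain strict transforms until it is a unit, which puts `z` or `z⁻¹` in the union. It also shows that
each nonzero `b` in `V` divides a power of every nonunit, so `V` has dimension one and its value
group is archimedean, hence embeds in `ℝ`.

For the limit: if `p * v g < d * v f`, then `f ^ d / g ^ p` is a nonunit of `V`, hence of `R n` for
large `n`, and additivity yields `p * ord g < d * ord f`. Squeezing between rationals finishes. -/

namespace QuadraticTransform

/-! ### Quasi-regularity of a regular system of parameters. -/

section QuasiRegular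

/-- If some coefficient were a unit, the reduced polynomial would be nonzero at a point `a` over the
infinite residue field. Lift `a` to `b` and kill all `x j - b j * x₀`: the sum becomes `x₀ ^ r`
times a unit and also a multiple of `x₀ ^ (r + 1)`, so `x₀` is nilpotent modulo `I`. Then the
maximal ideal is minimal over an ideal with `card σ` generators, against Krull's height theorem. -/
theorem coeff_mem_of_sum_mem_pow_succ_of_infinite {A σ : Type*} [CommRing A] [IsLocalRing A]
    [IsNoetherianRing A] [Fintype σ] [Infinite (ResidueField A)] (x₀ : A) (x : σ → A)
    (hspan : maximalIdeal A = Ideal.span (insert x₀ (Set.range x)))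
    (hdim : (Fintype.card σ : ℕ∞) < (maximalIdeal A).height) (r : ℕ) (s : Finset (σ →₀ ℕ))
    (hs : ∀ m ∈ s, m.degree ≤ r) (c : (σ →₀ ℕ) → A)
    (h : ∑ m ∈ s, c m * (x₀ ^ (r - m.degree) * m.prod fun j e => x j ^ e) ∈
      maximalIdeal A ^ (r + 1)) : ∀ m ∈ s, c m ∈ maximalIdeal A := by
  classical
  by_contra! hc
  obtain ⟨m₀, hm₀, hcm₀⟩ := hc
  set P : MvPolynomial σ (ResidueField A) :=
    ∑ m ∈ s, MvPolynomial.monomial m (residue A (c m)) with hP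
  have hP0 : P ≠ 0 := by
    intro h0
    have h1 : P.coeff m₀ = residue A (c m₀) := by
      rw [hP, MvPolynomial.coeff_sum, Finset.sum_eq_single m₀]
      · simp
      · intro b _ hb
        simp [MvPolynomial.coeff_monomial, hb]
      · exact fun h => absurd hm₀ h
    rw [h0, MvPolynomial.coeff_zero] at h1
    exact hcm₀ ((residue_eq_zero_iff _).mp h1.symm)
  obtain ⟨a, ha⟩ : ∃ a, MvPolynomial.eval a P ≠ 0 := by
    by_contra! hall
    exact hP0 (MvPolynomial.funext fun a => by simpa using hall a)
  choose b hb using fun j => residue_surjective (a j)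
  set u : A := ∑ m ∈ s, c m * m.prod fun j e => b j ^ e with hu
  have hu_unit : IsUnit u := by
    rw [← residue_ne_zero_iff_isUnit]
    convert ha using 1
    rw [hu, hP, map_sum, map_sum]
    refine Finset.sum_congr rfl fun m _ => ?_
    rw [map_mul, MvPolynomial.eval_monomial, Finsupp.prod, Finsupp.prod, map_prod]
    simp [hb]
  set I : Ideal A := Ideal.span (Set.range fun j => x j - b j * x₀) with hI
  have hIm : I ≤ maximalIdeal A := by
    rw [hI, Ideal.span_le]
    rintro _ ⟨j, rfl⟩
    have h0 : x₀ ∈ maximalIdeal A := hspan ▸ Ideal.subset_span (Set.mem_insert _ _)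
    have h1 : x j ∈ maximalIdeal A :=
      hspan ▸ Ideal.subset_span (Set.mem_insert_of_mem _ ⟨j, rfl⟩)
    exact sub_mem h1 (Ideal.mul_mem_left _ _ h0)
  have hxj (j : σ) : Ideal.Quotient.mk I (x j) =
      Ideal.Quotient.mk I (b j) * Ideal.Quotient.mk I x₀ := by
    rw [← map_mul, Ideal.Quotient.eq]
    exact Ideal.subset_span ⟨j, rfl⟩
  have hmap : (maximalIdeal A).map (Ideal.Quotient.mk I) ≤
      Ideal.span {Ideal.Quotient.mk I x₀} := by
    rw [hspan, Ideal.map_span, Ideal.span_le]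
    rintro _ ⟨y, rfl | ⟨j, rfl⟩, rfl⟩
    · exact Ideal.mem_span_singleton_self _
    · rw [hxj]
      exact Ideal.mul_mem_left _ _ (Ideal.mem_span_singleton_self _)
  have hsum : Ideal.Quotient.mk I
      (∑ m ∈ s, c m * (x₀ ^ (r - m.degree) * m.prod fun j e => x j ^ e)) =
      Ideal.Quotient.mk I (x₀ ^ r * u) := by
    rw [map_sum, hu, Finset.mul_sum, map_sum]
    refine Finset.sum_congr rfl fun m hm => ?_
    have h1 : Ideal.Quotient.mk I (m.prod fun j e => x j ^ e) =
        Ideal.Quotient.mk I (x₀ ^ m.degree * m.prod fun j e => b j ^ e) := by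
      rw [Finsupp.prod, map_prod, map_mul, Finsupp.degree_apply, map_pow, ← Finset.prod_pow_eq_pow_sum,
        Finsupp.prod, map_prod, ← Finset.prod_mul_distrib]
      refine Finset.prod_congr rfl fun j _ => ?_
      rw [map_pow, hxj, mul_pow, map_pow, mul_comm]
    have h2 : x₀ ^ r = x₀ ^ (r - m.degree) * x₀ ^ m.degree := by
      rw [← pow_add, Nat.sub_add_cancel (hs m hm)]
    rw [map_mul, map_mul, h1, ← map_mul, ← map_mul, h2]
    congr 1
    ring
  have hmem : Ideal.Quotient.mk I (x₀ ^ r * u) ∈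
      Ideal.span {Ideal.Quotient.mk I x₀ ^ (r + 1)} := by
    rw [← hsum, ← Ideal.span_singleton_pow]
    have := Ideal.mem_map_of_mem (Ideal.Quotient.mk I) h
    rw [Ideal.map_pow] at this
    exact Ideal.pow_right_mono hmap _ this
  have hx₀m : x₀ ∈ maximalIdeal A := hspan ▸ Ideal.subset_span (Set.mem_insert _ _)
  have hpow : x₀ ^ r ∈ I := by
    obtain ⟨t, ht⟩ := Ideal.mem_span_singleton'.mp hmem
    obtain ⟨t, rfl⟩ := Ideal.Quotient.mk_surjective t
    rw [← map_pow, ← map_mul, Ideal.Quotient.eq] at ht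
    have h3 : IsUnit (t * x₀ - u) := by
      by_contra h4
      have h5 : t * x₀ - (t * x₀ - u) ∈ maximalIdeal A :=
        sub_mem (Ideal.mul_mem_left _ _ hx₀m) ((mem_maximalIdeal _).mpr h4)
      rw [sub_sub_cancel] at h5
      exact (mem_maximalIdeal _).mp h5 hu_unit
    have h6 : x₀ ^ r * (t * x₀ - u) ∈ I := by convert ht using 1; ring
    exact (Ideal.mul_unit_mem_iff_mem _ h3).mp h6
  have hmin : maximalIdeal A ∈ I.minimalPrimes := by
    refine ⟨⟨inferInstance, hIm⟩, fun q hq _ => ?_⟩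
    have := hq.1
    have h0 : x₀ ∈ q := this.mem_of_pow_mem _ (hq.2 hpow)
    rw [hspan, Ideal.span_le]
    rintro _ (rfl | ⟨j, rfl⟩)
    · exact h0
    · have : x j - b j * x₀ ∈ q := hq.2 (Ideal.subset_span ⟨j, rfl⟩)
      simpa using add_mem this (Ideal.mul_mem_left _ (b j) h0)
  refine absurd (Ideal.height_le_card_of_mem_minimalPrimes_span (Set.finite_range _) hmin)
    (not_le.mpr (lt_of_le_of_lt ?_ hdim))
  rw [← Set.image_univ, ← Nat.card_eq_fintype_card, ← Set.ncard_univ]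
  exact_mod_cast Set.ncard_image_le

/-- Replacing `A` by `A[X]` localized at `𝔪A[X]` keeps the generators and the height, makes the
residue field infinite, and reflects membership of constants in the maximal ideal. -/
theorem coeff_mem_of_sum_mem_pow_succ {A σ : Type*} [CommRing A] [IsLocalRing A]
    [IsNoetherianRing A] [Fintype σ] (x₀ : A) (x : σ → A)
    (hspan : maximalIdeal A = Ideal.span (insert x₀ (Set.range x)))
    (hdim : (Fintype.card σ : ℕ∞) < (maximalIdeal A).height) (r : ℕ) (s : Finset (σ →₀ ℕ))
    (hs : ∀ m ∈ s, m.degree ≤ r) (c : (σ →₀ ℕ) → A)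
    (h : ∑ m ∈ s, c m * (x₀ ^ (r - m.degree) * m.prod fun j e => x j ^ e) ∈
      maximalIdeal A ^ (r + 1)) : ∀ m ∈ s, c m ∈ maximalIdeal A := by
  set p : Ideal (Polynomial A) := (maximalIdeal A).map Polynomial.C with hp
  have hpp : p.IsPrime := Ideal.isPrime_map_C_of_isPrime
  let A' := Localization.AtPrime p
  let ι : A →+* A' := (algebraMap (Polynomial A) A').comp Polynomial.C
  have hmap : (maximalIdeal A).map ι = maximalIdeal A' := by
    rw [← Localization.AtPrime.map_eq_maximalIdeal, ← Ideal.map_map]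
  -- The powers of `X` stay distinct in the residue field, since `X ^ n - X ^ m` has a coefficient
  -- `1`.
  have hinj : Function.Injective fun n : ℕ =>
      residue A' (algebraMap (Polynomial A) A' (Polynomial.X ^ n)) := by
    intro n m hnm
    by_contra hne
    have h1 : algebraMap (Polynomial A) A' (Polynomial.X ^ n - Polynomial.X ^ m) ∈
        maximalIdeal A' := by
      rw [map_sub]
      exact Ideal.Quotient.eq.mp hnm
    rw [IsLocalization.AtPrime.to_map_mem_maximal_iff A' p, hp, Ideal.mem_map_C_iff] at h1
    have h2 := h1 n
    rw [Polynomial.coeff_sub, Polynomial.coeff_X_pow, Polynomial.coeff_X_pow, if_pos rfl,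
      if_neg hne, sub_zero] at h2
    exact (Ideal.ne_top_iff_one _).mp (maximalIdeal.isMaximal A).ne_top h2
  have hinf : Infinite (ResidueField A') := Infinite.of_injective _ hinj
  have hdim' : (Fintype.card σ : ℕ∞) < (maximalIdeal A').height := by
    have h1 : p.height = (maximalIdeal A).height := Polynomial.height_map_C _
    have h2 : p.height = (maximalIdeal A').height := by
      conv_lhs => rw [← IsLocalization.AtPrime.under_maximalIdeal A' p]
      exact IsLocalization.height_under p.primeCompl _
    rwa [← h2, h1]
  have hspan' : maximalIdeal A' = Ideal.span (insert (ι x₀) (Set.range (ι ∘ x))) := by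
    rw [← hmap, hspan, Ideal.map_span, Set.image_insert_eq, Set.range_comp]
  have key := coeff_mem_of_sum_mem_pow_succ_of_infinite (ι x₀) (ι ∘ x) hspan' hdim' r s hs
    (fun m => ι (c m)) (by
      have := Ideal.mem_map_of_mem ι h
      rw [Ideal.map_pow, hmap, map_sum] at this
      convert this using 2 with m hm
      simp [Finsupp.prod, map_prod])
  intro m hm
  have := key m hm
  change algebraMap (Polynomial A) A' (Polynomial.C (c m)) ∈ _ at this
  rw [IsLocalization.AtPrime.to_map_mem_maximal_iff A' p, hp, Ideal.mem_map_C_iff] at this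
  simpa using this 0

end QuasiRegular
-- The chart `A[𝔪/x₀]` and its reduction modulo `x₀`.
section Chart

variable {K : Type*} [Field K] (A : LocalSubring K)

/-- The elements `x₀` and `x j`, `j : σ`, generate the maximal ideal of `A`, and their number is
at most the dimension of `A`. -/
structure IsParameterSystem {A : LocalSubring K} {σ : Type*} [Fintype σ] (x₀ : A.toSubring)
    (x : σ → A.toSubring) : Prop where
  ne_zero : x₀ ≠ 0
  span_eq : maximalIdeal A.toSubring = Ideal.span (insert x₀ (Set.range x))
  card_lt : (Fintype.card σ : ℕ∞) < (maximalIdeal A.toSubring).height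

/-- Exchange argument: as `x₀ ∉ 𝔪²`, it has a unit coefficient at some member of a minimal
generating set and can replace that member. -/
theorem exists_isParameterSystem {A : LocalSubring K} [IsRegularLocalRing A.toSubring]
    {x₀ : A.toSubring} (hx : x₀ ∈ maximalIdeal A.toSubring)
    (hx' : x₀ ∉ maximalIdeal A.toSubring ^ 2) :
    ∃ (s : Finset A.toSubring), IsParameterSystem x₀ ((↑) : s → A.toSubring) := by
  classical
  have fg := (maximalIdeal A.toSubring).fg_of_isNoetherianRing
  have fin := Submodule.FG.finite_generators fg
  set S := fin.toFinset with hS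
  have hspan : Ideal.span (S : Set A.toSubring) = maximalIdeal A.toSubring := by
    rw [hS, Set.Finite.coe_toFinset]
    exact Submodule.span_generators _
  have hcard : (S.card : ℕ∞) = (maximalIdeal A.toSubring).height := by
    have h1 := IsRegularLocalRing.spanFinrank_maximalIdeal (R := A.toSubring)
    rw [← maximalIdeal_height_eq_ringKrullDim, ← Submodule.FG.generators_ncard fg,
      Set.ncard_eq_toFinset_card _ fin] at h1
    exact_mod_cast h1
  have hx₀ : x₀ ∈ Submodule.span A.toSubring (S : Set A.toSubring) := by
    rw [← hspan] at hx
    exact hx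
  obtain ⟨a, -, ha⟩ := Submodule.mem_span_finset.mp hx₀
  obtain ⟨s₀, hs₀, hu⟩ : ∃ s₀ ∈ S, IsUnit (a s₀) := by
    by_contra! h
    refine hx' (ha ▸ Ideal.sum_mem _ fun s hs => ?_)
    rw [pow_two]
    exact Ideal.mul_mem_mul ((mem_maximalIdeal _).mpr (h s hs)) (hspan ▸ Ideal.subset_span hs)
  refine ⟨S.erase s₀, ?_, ?_, ?_⟩
  · rintro rfl
    exact hx' (zero_mem _)
  · rw [Subtype.range_coe_subtype]
    apply le_antisymm
    · rw [← hspan, Ideal.span_le]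
      intro s hs
      by_cases hss : s = s₀
      · subst hss
        rw [SetLike.mem_coe, ← Ideal.unit_mul_mem_iff_mem _ hu]
        rw [← Finset.add_sum_erase _ _ hs₀] at ha
        have h1 : a s * s = x₀ - ∑ t ∈ S.erase s, a t • t := by
          rw [← ha]; simp
        rw [h1]
        refine sub_mem (Ideal.subset_span (Set.mem_insert _ _)) (Ideal.sum_mem _ fun t ht => ?_)
        exact Ideal.mul_mem_left _ _ (Ideal.subset_span (Set.mem_insert_of_mem _ ht))
      · exact Ideal.subset_span (Set.mem_insert_of_mem _ (Finset.mem_erase.mpr ⟨hss, hs⟩))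
    · rw [Ideal.span_le]
      rintro s (rfl | hs)
      · exact hx
      · exact hspan ▸ Ideal.subset_span (Finset.mem_of_mem_erase hs)
  · rw [← hcard, Fintype.card_coe]
    exact_mod_cast Finset.card_erase_lt_of_mem hs₀

variable {A}
variable {σ : Type*} {x₀ : A.toSubring} {x : σ → A.toSubring}

/-- The evaluation of polynomials with coefficients in `A` at the fractions `x j / x₀`. -/
noncomputable def chartMap (x₀ : A.toSubring) (x : σ → A.toSubring) :
    MvPolynomial σ A.toSubring →ₐ[A.toSubring] K :=
  MvPolynomial.aeval fun j => (x j : K) / (x₀ : K)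

theorem pow_mul_chartMap (hx₀ : x₀ ≠ 0) (x : σ → A.toSubring) {r : ℕ}
    {H : MvPolynomial σ A.toSubring} (hH : H.totalDegree ≤ r) :
    (x₀ : K) ^ r * chartMap x₀ x H = ((∑ m ∈ H.support,
      H.coeff m * (x₀ ^ (r - m.degree) * m.prod fun j e => x j ^ e) : A.toSubring) : K) := by
  have hx₀' : (x₀ : K) ≠ 0 := by simpa using hx₀
  rw [chartMap, MvPolynomial.aeval_def, MvPolynomial.eval₂_eq, Finset.mul_sum,
    AddSubmonoidClass.coe_finsetSum]
  refine Finset.sum_congr rfl fun m hm => ?_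
  have hm' : m.degree ≤ r := (MvPolynomial.le_totalDegree hm).trans hH
  have h1 : (x₀ : K) ^ m.degree * ∏ i ∈ m.support, ((x i : K) / x₀) ^ m i =
      ∏ i ∈ m.support, (x i : K) ^ m i := by
    rw [Finsupp.degree_apply, ← Finset.prod_pow_eq_pow_sum, ← Finset.prod_mul_distrib]
    refine Finset.prod_congr rfl fun i _ => ?_
    rw [← mul_pow, mul_div_cancel₀ _ hx₀']
  have h2 : (x₀ : K) ^ r = (x₀ : K) ^ (r - m.degree) * (x₀ : K) ^ m.degree := by
    rw [← pow_add, Nat.sub_add_cancel hm']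
  rw [h2]
  push_cast [Finsupp.prod]
  rw [← h1]
  change _ = ((H.coeff m : A.toSubring) : K) * _
  change _ * (((H.coeff m : A.toSubring) : K) * _) = _
  ring

variable [Fintype σ] [IsNoetherianRing A.toSubring]

/-- Multiplying by `x₀ ^ r` homogenizes `H` to a form of degree `r` in the parameters; the final
equivalence is quasi-regularity. -/
theorem IsParameterSystem.exists_mem_pow (hp : IsParameterSystem x₀ x) {r : ℕ}
    {H : MvPolynomial σ A.toSubring} (hH : H.totalDegree ≤ r) :
    ∃ a ∈ maximalIdeal A.toSubring ^ r, (a : K) = (x₀ : K) ^ r * chartMap x₀ x H ∧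
      (H.map (residue A.toSubring) = 0 ↔ a ∈ maximalIdeal A.toSubring ^ (r + 1)) := by
  have hmon : ∀ m ∈ H.support, x₀ ^ (r - m.degree) * m.prod (fun j e => x j ^ e) ∈
      maximalIdeal A.toSubring ^ r := by
    intro m hm
    have hm' : m.degree ≤ r := (MvPolynomial.le_totalDegree hm).trans hH
    have h0 : x₀ ∈ maximalIdeal A.toSubring :=
      hp.span_eq ▸ Ideal.subset_span (Set.mem_insert _ _)
    have h1 (j) : x j ∈ maximalIdeal A.toSubring :=
      hp.span_eq ▸ Ideal.subset_span (Set.mem_insert_of_mem _ ⟨j, rfl⟩)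
    have h2 : m.prod (fun j e => x j ^ e) ∈ maximalIdeal A.toSubring ^ m.degree := by
      rw [Finsupp.prod, Finsupp.degree_apply, ← Finset.prod_pow_eq_pow_sum]
      exact Ideal.prod_mem_prod fun i _ => Ideal.pow_mem_pow (h1 i) _
    have h3 := Ideal.mul_mem_mul (Ideal.pow_mem_pow h0 (r - m.degree)) h2
    rwa [← pow_add, Nat.sub_add_cancel hm'] at h3
  refine ⟨_, Ideal.sum_mem _ fun m hm => Ideal.mul_mem_left _ _ (hmon m hm),
    (pow_mul_chartMap hp.ne_zero x hH).symm, fun h => ?_, fun h => ?_⟩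
  · refine Ideal.sum_mem _ fun m hm => ?_
    rw [pow_succ']
    refine Ideal.mul_mem_mul ?_ (hmon m hm)
    rw [← residue_eq_zero_iff, ← MvPolynomial.coeff_map, h, MvPolynomial.coeff_zero]
  · ext m
    rw [MvPolynomial.coeff_map, MvPolynomial.coeff_zero]
    by_cases hm : m ∈ H.support
    · exact (residue_eq_zero_iff _).mpr <| coeff_mem_of_sum_mem_pow_succ x₀ x hp.span_eq
        hp.card_lt r _ (fun m hm => (MvPolynomial.le_totalDegree hm).trans hH) _ h m hm
    · rw [MvPolynomial.notMem_support_iff.mp hm, map_zero]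

omit [IsNoetherianRing A.toSubring] in
theorem IsParameterSystem.exists_chartMap (hp : IsParameterSystem x₀ x) {r : ℕ}
    {a : A.toSubring} (ha : a ∈ maximalIdeal A.toSubring ^ r) :
    ∃ H : MvPolynomial σ A.toSubring, H.totalDegree ≤ r ∧
      (a : K) = (x₀ : K) ^ r * chartMap x₀ x H := by
  have hx₀' : (x₀ : K) ≠ 0 := by simpa using hp.ne_zero
  have hC (b : A.toSubring) : chartMap x₀ x (MvPolynomial.C b) = (b : K) :=
    MvPolynomial.aeval_C _ _
  have h1 : ∀ y ∈ maximalIdeal A.toSubring, ∃ H : MvPolynomial σ A.toSubring,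
      H.totalDegree ≤ 1 ∧ (y : K) = x₀ * chartMap x₀ x H := by
    intro y hy
    rw [hp.span_eq] at hy
    induction hy using Submodule.span_induction with
    | mem y hy =>
      obtain rfl | ⟨j, rfl⟩ := hy
      · exact ⟨1, by simp, by simp⟩
      · refine ⟨MvPolynomial.X j, (MvPolynomial.totalDegree_X j).le, ?_⟩
        rw [chartMap, MvPolynomial.aeval_X, mul_div_cancel₀ _ hx₀']
    | zero => exact ⟨0, by simp, by simp⟩
    | add y z _ _ hy hz =>
      obtain ⟨H, hH, hy⟩ := hy
      obtain ⟨G, hG, hz⟩ := hz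
      refine ⟨H + G, (MvPolynomial.totalDegree_add _ _).trans (max_le hH hG), ?_⟩
      rw [map_add, mul_add, ← hy, ← hz]; rfl
    | smul b y _ hy =>
      obtain ⟨H, hH, hy⟩ := hy
      refine ⟨MvPolynomial.C b * H, (MvPolynomial.totalDegree_mul _ _).trans (by simpa), ?_⟩
      rw [map_mul, hC, mul_left_comm, ← hy]; rfl
  induction r generalizing a with
  | zero => exact ⟨MvPolynomial.C a, by simp, by simp [hC]⟩
  | succ r ih =>
    rw [pow_succ] at ha
    induction ha using Submodule.mul_induction_on' with
    | mem_mul_mem b hb c hc =>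
      obtain ⟨H, hH, hb⟩ := ih hb
      obtain ⟨G, hG, hc⟩ := h1 c hc
      refine ⟨H * G, (MvPolynomial.totalDegree_mul _ _).trans (by omega), ?_⟩
      rw [map_mul, Subring.coe_mul, hb, hc]
      ring
    | add b _ c _ hb hc =>
      obtain ⟨H, hH, hb⟩ := hb
      obtain ⟨G, hG, hc⟩ := hc
      refine ⟨H + G, (MvPolynomial.totalDegree_add _ _).trans (max_le hH hG), ?_⟩
      rw [map_add, mul_add, ← hb, ← hc]; rfl

/-- The graded ring is a domain: dehomogenized leading forms are nonzero polynomials over the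
residue field, and so is their product. -/
theorem IsParameterSystem.mul_notMem_pow (hp : IsParameterSystem x₀ x) {r s : ℕ}
    {a b : A.toSubring} (ha : a ∈ maximalIdeal A.toSubring ^ r)
    (ha' : a ∉ maximalIdeal A.toSubring ^ (r + 1)) (hb : b ∈ maximalIdeal A.toSubring ^ s)
    (hb' : b ∉ maximalIdeal A.toSubring ^ (s + 1)) :
    a * b ∉ maximalIdeal A.toSubring ^ (r + s + 1) := by
  obtain ⟨H, hH, haH⟩ := hp.exists_chartMap ha
  obtain ⟨G, hG, hbG⟩ := hp.exists_chartMap hb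
  obtain ⟨a', -, haa, ha''⟩ := hp.exists_mem_pow hH
  obtain ⟨b', -, hbb, hb''⟩ := hp.exists_mem_pow hG
  obtain ⟨c, -, hc, hc'⟩ := hp.exists_mem_pow (H := H * G) (r := r + s)
    ((MvPolynomial.totalDegree_mul _ _).trans (by omega))
  obtain rfl : a' = a := Subtype.ext (haa.trans haH.symm)
  obtain rfl : b' = b := Subtype.ext (hbb.trans hbG.symm)
  obtain rfl : c = a' * b' := Subtype.ext (by
    rw [hc, Subring.coe_mul, haa, hbb, map_mul]; ring)
  rw [← hc', map_mul, mul_eq_zero, ha'', hb'']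
  exact not_or.mpr ⟨ha', hb'⟩

omit [IsNoetherianRing A.toSubring] in
theorem IsParameterSystem.chart_eq_range (hp : IsParameterSystem x₀ x) :
    chart A x₀ = (chartMap x₀ x).toRingHom.range := by
  have hx₀' : (x₀ : K) ≠ 0 := by simpa using hp.ne_zero
  apply le_antisymm
  · rw [chart, Subring.closure_le]
    rintro z (hz | ⟨y, hy, rfl⟩)
    · exact ⟨MvPolynomial.C ⟨z, hz⟩, MvPolynomial.aeval_C _ _⟩
    · obtain ⟨H, -, hH⟩ := hp.exists_chartMap (r := 1) (by simpa using hy)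
      refine ⟨H, ?_⟩
      rw [hH, pow_one, mul_div_cancel_left₀ _ hx₀']; rfl
  · rintro _ ⟨H, rfl⟩
    change chartMap x₀ x H ∈ chart A x₀
    induction H using MvPolynomial.induction_on with
    | C a =>
      rw [chartMap, MvPolynomial.aeval_C]
      exact le_chart A x₀ a.2
    | add p q hp hq => rw [map_add]; exact add_mem hp hq
    | mul_X p j hq =>
      rw [map_mul]
      refine mul_mem hq (Subring.subset_closure (Or.inr ⟨x j, ?_, ?_⟩))
      · exact hp.span_eq ▸ Ideal.subset_span (Set.mem_insert_of_mem _ ⟨j, rfl⟩)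
      · rw [chartMap, MvPolynomial.aeval_X]

/-- By quasi-regularity, a polynomial vanishing at the fractions `x j / x₀` has all its coefficients
in `𝔪`. So reduction of coefficients descends to the chart. -/
theorem IsParameterSystem.exists_chart_hom (hp : IsParameterSystem x₀ x) :
    ∃ φ : chart A x₀ →+* MvPolynomial σ (ResidueField A.toSubring), Function.Surjective φ ∧
      (∀ (H : MvPolynomial σ A.toSubring) (b : chart A x₀), (b : K) = chartMap x₀ x H →
        φ b = H.map (residue A.toSubring)) ∧
      RingHom.ker φ = Ideal.span {Subring.inclusion (le_chart A x₀) x₀} := by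
  have hx₀' : (x₀ : K) ≠ 0 := by simpa using hp.ne_zero
  have hmem (H) : chartMap x₀ x H ∈ chart A x₀ := hp.chart_eq_range ▸ ⟨H, rfl⟩
  let g : MvPolynomial σ A.toSubring →+* chart A x₀ :=
    (chartMap x₀ x).toRingHom.codRestrict (chart A x₀) hmem
  have hg : Function.Surjective g := by
    rintro ⟨b, hb⟩
    rw [hp.chart_eq_range] at hb
    obtain ⟨H, hH⟩ := hb
    exact ⟨H, Subtype.ext hH⟩
  have hker : RingHom.ker g ≤ RingHom.ker (MvPolynomial.map (σ := σ) (residue A.toSubring)) := by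
    intro H hH
    obtain ⟨a, -, ha, ha'⟩ := hp.exists_mem_pow (le_refl H.totalDegree)
    have h1 : chartMap x₀ x H = 0 := congrArg Subtype.val (show g H = 0 from hH)
    obtain rfl : a = 0 := Subtype.ext (by rw [ha, h1, mul_zero]; rfl)
    exact ha'.mpr (zero_mem _)
  let φ := g.liftOfSurjective hg ⟨MvPolynomial.map (residue A.toSubring), hker⟩
  have hφ (H) (b : chart A x₀) (hb : (b : K) = chartMap x₀ x H) :
      φ b = H.map (residue A.toSubring) := by
    obtain rfl : b = g H := Subtype.ext hb
    exact RingHom.liftOfRightInverse_comp_apply _ _ _ _ _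
  refine ⟨φ, ?_, hφ, ?_⟩
  · intro q
    obtain ⟨H, rfl⟩ := MvPolynomial.map_surjective _ residue_surjective q
    exact ⟨g H, hφ H _ rfl⟩
  · apply le_antisymm
    · intro b hb
      obtain ⟨H, rfl⟩ := hg b
      rw [RingHom.mem_ker, hφ H _ rfl] at hb
      obtain ⟨a, -, ha, ha'⟩ := hp.exists_mem_pow (le_refl H.totalDegree)
      -- Vanishing coefficients modulo `𝔪` put `x₀ ^ r * H(x / x₀)` in `𝔪 ^ (r + 1)`, where it
      -- equals `x₀ ^ (r + 1) * G(x / x₀)`; cancelling `x₀ ^ r` exhibits the factor `x₀`.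
      obtain ⟨G, -, hG⟩ := hp.exists_chartMap (ha'.mp hb)
      refine Ideal.mem_span_singleton'.mpr ⟨g G, Subtype.ext ?_⟩
      change chartMap x₀ x G * x₀ = chartMap x₀ x H
      refine mul_left_cancel₀ (pow_ne_zero H.totalDegree hx₀') ?_
      rw [← ha, hG]
      ring
    · rw [Ideal.span_singleton_le_iff_mem, RingHom.mem_ker,
        hφ (MvPolynomial.C x₀) _ (MvPolynomial.aeval_C _ _).symm, MvPolynomial.map_C,
        (residue_eq_zero_iff x₀).mpr, map_zero]
      exact hp.span_eq ▸ Ideal.subset_span (Set.mem_insert _ _)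

end Chart
-- Degree bounds the order of a polynomial at a prime.
section PolynomialOrder

theorem totalDegree_aeval_X_add_C_le {D σ : Type*} [CommRing D] [Nontrivial D] (t : σ → D)
    (p : MvPolynomial σ D) :
    (MvPolynomial.aeval (fun j => MvPolynomial.X j + MvPolynomial.C (t j)) p :
      MvPolynomial σ D).totalDegree ≤ p.totalDegree := by
  rw [MvPolynomial.aeval_def, MvPolynomial.eval₂_eq]
  refine (MvPolynomial.totalDegree_finsetSum _ _).trans (Finset.sup_le fun m hm => ?_)
  refine le_trans ?_ (MvPolynomial.le_totalDegree hm)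
  refine (MvPolynomial.totalDegree_mul _ _).trans ?_
  rw [MvPolynomial.algebraMap_eq, MvPolynomial.totalDegree_C, zero_add]
  refine (MvPolynomial.totalDegree_finsetProd _ _).trans (Finset.sum_le_sum fun j _ => ?_)
  refine (MvPolynomial.totalDegree_pow _ _).trans ?_
  have : (MvPolynomial.X j + MvPolynomial.C (t j) : MvPolynomial σ D).totalDegree ≤ 1 :=
    (MvPolynomial.totalDegree_add _ _).trans (by simp)
  simpa using Nat.mul_le_mul_left (m j) this

/-- The order of a polynomial at a prime ideal is at most its degree. -/
theorem eq_zero_of_mul_mem_pow_of_totalDegree_lt {k σ : Type*} [Field k]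
    (Q : Ideal (MvPolynomial σ k)) [Q.IsPrime] {s h : MvPolynomial σ k} (hs : s ∉ Q) {n : ℕ}
    (hn : h.totalDegree < n) (hmem : s * h ∈ Q ^ n) : h = 0 := by
  -- Taylor expansion at the generic point `t` of `Q`, with coefficients in the domain `D`. The
  -- constant term is reduction modulo `Q`, so `Q ^ n` lands in order at least `n` and `s` in order
  -- zero. The translate of `h` then has order at least `n` but degree below `n`, hence vanishes,
  -- and translation is injective.
  let D := MvPolynomial σ k ⧸ Q
  let t : σ → D := fun j => Ideal.Quotient.mk Q (MvPolynomial.X j)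
  let sh : MvPolynomial σ D →ₐ[D] MvPolynomial σ D :=
    MvPolynomial.aeval fun j => MvPolynomial.X j + MvPolynomial.C (t j)
  let sh' : MvPolynomial σ D →ₐ[D] MvPolynomial σ D :=
    MvPolynomial.aeval fun j => MvPolynomial.X j - MvPolynomial.C (t j)
  have hsh : sh'.comp sh = AlgHom.id D _ := by
    ext j
    simp [sh, sh']
  have hshinj : Function.Injective sh := by
    refine Function.LeftInverse.injective (g := sh') fun p => ?_
    exact congrArg (fun f : MvPolynomial σ D →ₐ[D] MvPolynomial σ D => f p) hsh
  let mp : MvPolynomial σ k →+* MvPolynomial σ D := MvPolynomial.map (algebraMap k D)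
  have hmp : Function.Injective mp := MvPolynomial.map_injective _ (algebraMap k D).injective
  let θ : MvPolynomial σ k →+* MvPowerSeries σ D :=
    MvPolynomial.coeToMvPowerSeries.ringHom.comp ((sh : MvPolynomial σ D →+* _).comp mp)
  have hθ (p) : θ p = ((sh (mp p) : MvPolynomial σ D) : MvPowerSeries σ D) := rfl
  have hconst : (MvPowerSeries.constantCoeff (σ := σ) (R := D)).comp θ = Ideal.Quotient.mk Q := by
    apply MvPolynomial.ringHom_ext
    · intro c
      rw [RingHom.comp_apply, hθ]
      simp only [mp, sh, MvPolynomial.map_C, MvPolynomial.aeval_C, MvPolynomial.algebraMap_eq,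
        MvPolynomial.coe_C, MvPowerSeries.constantCoeff_C]
      rfl
    · intro j
      rw [RingHom.comp_apply, hθ]
      simp only [mp, sh, MvPolynomial.map_X, MvPolynomial.aeval_X, MvPolynomial.coe_C,
        MvPolynomial.coe_add, MvPolynomial.coe_X, map_add, MvPowerSeries.constantCoeff_C,
        MvPowerSeries.constantCoeff_X, zero_add]
      rfl
  have hQ : ∀ p ∈ Q, 1 ≤ (θ p).order := fun p hp => by
    rw [MvPowerSeries.one_le_order_iff_constCoeff_eq_zero, ← RingHom.comp_apply, hconst]
    exact Ideal.Quotient.eq_zero_iff_mem.mpr hp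
  have hQn : ∀ (n : ℕ), ∀ p ∈ Q ^ n, (n : ℕ∞) ≤ (θ p).order := by
    intro n
    induction n with
    | zero => simp
    | succ n ih =>
      intro p hp
      rw [pow_succ] at hp
      induction hp using Submodule.mul_induction_on' with
      | mem_mul_mem a ha b hb =>
        rw [map_mul, Nat.cast_add]
        exact (add_le_add (ih a ha) (by simpa using hQ b hb)).trans MvPowerSeries.le_order_mul
      | add a _ b _ ha hb =>
        rw [map_add]
        exact (le_min ha hb).trans MvPowerSeries.min_order_le_add
  have hs0 : (θ s).order = 0 := by
    by_contra h0
    rw [← ne_eq, MvPowerSeries.order_ne_zero_iff_constCoeff_eq_zero, ← RingHom.comp_apply,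
      hconst] at h0
    exact hs (Ideal.Quotient.eq_zero_iff_mem.mp h0)
  have hord : (n : ℕ∞) ≤ (θ h).order := by
    have := hQn n _ hmem
    rwa [map_mul, MvPowerSeries.order_mul, hs0, zero_add] at this
  have hzero : sh (mp h) = 0 := by
    ext d
    rw [MvPolynomial.coeff_zero]
    by_cases hd : d.degree < n
    · rw [← MvPolynomial.coeff_coe, ← hθ]
      exact MvPowerSeries.coeff_of_lt_order (lt_of_lt_of_le (by exact_mod_cast hd) hord)
    · refine MvPolynomial.coeff_eq_zero_of_totalDegree_lt ?_
      refine lt_of_lt_of_le ?_ (not_lt.mp hd)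
      refine lt_of_le_of_lt (totalDegree_aeval_X_add_C_le t _) (lt_of_le_of_lt ?_ hn)
      exact Finset.sup_mono (MvPolynomial.support_map_subset _ _)
  exact hmp (hshinj (by rw [hzero, map_zero, map_zero]))

end PolynomialOrder

/-! ### Lifting regularity from a quotient, and localizing surjections. -/

section Quotient

/-- Lifted generators together with `x` generate the maximal ideal of `B`, so it needs at most `dim
C + 1` generators, and `dim C + 1 ≤ dim B` as `x` is a nonzerodivisor. -/
theorem isRegularLocalRing_of_surjective {B C : Type*} [CommRing B] [IsLocalRing B]
    [IsNoetherianRing B] [IsDomain B] [CommRing C] [IsRegularLocalRing C] (ψ : B →+* C)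
    (hψ : Function.Surjective ψ) {x : B} (hx : x ≠ 0) (hker : RingHom.ker ψ = Ideal.span {x}) :
    IsRegularLocalRing B := by
  classical
  apply IsRegularLocalRing.of_spanFinrank_maximalIdeal_le
  have hψx : ψ x = 0 := by
    rw [← RingHom.mem_ker, hker]
    exact Ideal.mem_span_singleton_self x
  refine le_trans ?_ (ringKrullDim_succ_le_of_surjective ψ hψ (mem_nonZeroDivisors_of_ne_zero hx)
    hψx)
  rw [← IsRegularLocalRing.spanFinrank_maximalIdeal (R := C)]
  have fg := (maximalIdeal C).fg_of_isNoetherianRing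
  have fin := Submodule.FG.finite_generators fg
  rw [← Submodule.FG.generators_ncard fg]
  have hlocal : IsLocalHom ψ := .of_surjective ψ hψ
  choose l hl using hψ
  have hspan : maximalIdeal B = Ideal.span (insert x (l '' (maximalIdeal C).generators)) := by
    apply le_antisymm
    · intro b hb
      have hb' : ψ b ∈ Ideal.map ψ (Ideal.span (l '' (maximalIdeal C).generators)) := by
        rw [Ideal.map_span, ← Set.image_comp]
        have : ψ ∘ l = id := funext hl
        rw [this, Set.image_id]
        have h1 : ψ b ∈ maximalIdeal C := by
          rw [mem_maximalIdeal] at hb ⊢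
          exact fun h => hb (isUnit_of_map_unit ψ b h)
        rw [← Submodule.span_generators (maximalIdeal C)] at h1
        exact h1
      obtain ⟨c, hc, hcb⟩ := (Ideal.mem_map_iff_of_surjective ψ (fun y => ⟨l y, hl y⟩)).mp hb'
      have h2 : b - c ∈ RingHom.ker ψ := by rw [RingHom.mem_ker, map_sub, hcb, sub_self]
      rw [hker] at h2
      rw [← sub_add_cancel b c, Ideal.span_insert]
      exact add_mem (Ideal.mem_sup_left h2) (Ideal.mem_sup_right hc)
    · rw [Ideal.span_le]
      rintro b hb
      rw [SetLike.mem_coe, mem_maximalIdeal]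
      intro hu
      have h3 : ψ b ∈ maximalIdeal C := by
        obtain rfl | ⟨c, hc, rfl⟩ := hb
        · rw [hψx]; exact zero_mem _
        · rw [hl, ← Submodule.span_generators (maximalIdeal C)]
          exact Submodule.subset_span hc
      exact (mem_maximalIdeal _).mp h3 (hu.map ψ)
  have hfin := fin.image l
  have h4 : (maximalIdeal B).spanFinrank ≤ (maximalIdeal C).generators.ncard + 1 := by
    rw [hspan]
    refine (Submodule.spanFinrank_span_le_ncard_of_finite (hfin.insert x)).trans ?_
    exact (Set.ncard_insert_le _ _).trans (Nat.add_le_add_right (Set.ncard_image_le fin) 1)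
  exact_mod_cast h4

/-- A surjection of rings induces a surjection of the localizations at corresponding primes. -/
theorem exists_surjective_localization {S T B : Type*} [CommRing S] [CommRing T] [IsDomain T]
    [CommRing B] [Algebra S B] (P : Ideal S) [P.IsPrime] [IsLocalization.AtPrime B P]
    (φ : S →+* T) (hφ : Function.Surjective φ) (hker : RingHom.ker φ ≤ P) :
    ∃ (Q : Ideal T) (_ : Q.IsPrime) (ψ : B →+* Localization.AtPrime Q), Function.Surjective ψ ∧
      (∀ a, ψ (algebraMap S B a) = algebraMap T _ (φ a)) ∧
      RingHom.ker ψ = (RingHom.ker φ).map (algebraMap S B) := by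
  have hQ : (P.map φ).IsPrime := Ideal.map_isPrime_of_surjective hφ hker
  have hcomap : (P.map φ).comap φ = P := by
    rw [Ideal.comap_map_of_surjective' _ hφ, sup_eq_left]
    exact hker
  have hle : P.primeCompl ≤ (P.map φ).primeCompl.comap φ := fun s hs h => hs (by
    rw [← hcomap]; exact h)
  let ψ : B →+* Localization.AtPrime (P.map φ) := IsLocalization.map _ φ hle
  have hψ (a) : ψ (algebraMap S B a) = algebraMap T _ (φ a) := IsLocalization.map_eq hle a
  refine ⟨P.map φ, hQ, ψ, ?_, hψ, ?_⟩
  · intro c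
    obtain ⟨t, u, rfl⟩ := IsLocalization.exists_mk'_eq (P.map φ).primeCompl c
    obtain ⟨a, rfl⟩ := hφ t
    obtain ⟨s, hs⟩ := hφ u
    have hsP : s ∈ P.primeCompl := fun h => u.2 (hs ▸ Ideal.mem_map_of_mem φ h)
    refine ⟨IsLocalization.mk' B a (⟨s, hsP⟩ : P.primeCompl), ?_⟩
    rw [IsLocalization.map_mk' hle]
    congr 1
    exact Subtype.ext hs
  · apply le_antisymm
    · intro b hb
      obtain ⟨a, s, rfl⟩ := IsLocalization.exists_mk'_eq P.primeCompl b
      rw [RingHom.mem_ker, IsLocalization.map_mk' hle, IsLocalization.mk'_eq_zero_iff] at hb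
      obtain ⟨m, hm⟩ := hb
      have hm0 : (m : T) ≠ 0 := fun h => m.2 (h ▸ zero_mem _)
      have ha : a ∈ RingHom.ker φ := (mul_eq_zero.mp hm).resolve_left hm0
      rw [IsLocalization.mk'_eq_mul_mk'_one]
      exact Ideal.mul_mem_right _ _ (Ideal.mem_map_of_mem _ ha)
    · rw [Ideal.map_le_iff_le_comap]
      intro a ha
      rw [Ideal.mem_comap, RingHom.mem_ker, hψ, (RingHom.mem_ker).mp ha, map_zero]

end Quotient
-- The order function of a regular local ring.
section Order

variable {K : Type*} [Field K]

/-- The element `f` of `K` belongs to the `r`-th power of the maximal ideal of `A`. -/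
def MemPow (A : LocalSubring K) (r : ℕ) (f : K) : Prop :=
  ∃ a ∈ maximalIdeal A.toSubring ^ r, (a : K) = f

variable {A B : LocalSubring K} {f g : K} {r s : ℕ}

theorem MemPow.mem (h : MemPow A r f) : f ∈ A.toSubring := by
  obtain ⟨a, -, rfl⟩ := h
  exact a.2

theorem MemPow.mono (h : MemPow A r f) (hs : s ≤ r) : MemPow A s f := by
  obtain ⟨a, ha, rfl⟩ := h
  exact ⟨a, Ideal.pow_le_pow_right hs ha, rfl⟩

theorem MemPow.mul (hf : MemPow A r f) (hg : MemPow A s g) : MemPow A (r + s) (f * g) := by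
  obtain ⟨a, ha, rfl⟩ := hf
  obtain ⟨b, hb, rfl⟩ := hg
  exact ⟨a * b, pow_add (maximalIdeal A.toSubring) r s ▸ Ideal.mul_mem_mul ha hb, rfl⟩

theorem memPow_zero_iff : MemPow A 0 f ↔ f ∈ A.toSubring :=
  ⟨MemPow.mem, fun h => ⟨⟨f, h⟩, by simp, rfl⟩⟩

/-- Zero needs its own disjunct, because `0⁻¹ = 0` lies in `A`. -/
theorem memPow_one_iff (hf : f ∈ A.toSubring) : MemPow A 1 f ↔ f = 0 ∨ f⁻¹ ∉ A.toSubring := by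
  have h1 : MemPow A 1 f ↔ ¬ IsUnit (⟨f, hf⟩ : A.toSubring) := by
    rw [← mem_nonunits_iff, ← mem_maximalIdeal, MemPow, pow_one]
    exact ⟨fun ⟨a, ha, h⟩ => by
      obtain rfl : a = ⟨f, hf⟩ := Subtype.ext h
      exact ha, fun h => ⟨_, h, rfl⟩⟩
  rw [h1]
  constructor
  · intro h
    by_contra! hc
    exact h (.of_mul_eq_one ⟨f⁻¹, hc.2⟩ (Subtype.ext (mul_inv_cancel₀ hc.1)))
  · rintro h hu
    obtain ⟨b, hb⟩ := hu.exists_right_inv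
    have hb' : f * (b : K) = 1 := congrArg Subtype.val hb
    have hf0 : f ≠ 0 := left_ne_zero_of_mul_eq_one hb'
    refine h.elim hf0 fun h => h ?_
    rw [← eq_inv_of_mul_eq_one_right hb']
    exact b.2

theorem MemPow.of_le (hAB : A ≤ B) (h : MemPow A r f) : MemPow B r f := by
  obtain ⟨hle, hloc⟩ := hAB
  obtain ⟨a, ha, rfl⟩ := h
  refine ⟨Subring.inclusion hle a, ?_, rfl⟩
  have h1 : (maximalIdeal A.toSubring).map (Subring.inclusion hle) ≤ maximalIdeal B.toSubring :=
    ((local_hom_TFAE _).out 0 2).mp hloc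
  have h2 := Ideal.mem_map_of_mem (Subring.inclusion hle) ha
  rw [Ideal.map_pow] at h2
  exact Ideal.pow_right_mono h1 _ h2

/-- Krull's intersection theorem bounds the set in the definition of `ord`, so its supremum is
attained. -/
theorem le_ord_iff [IsNoetherianRing A.toSubring] (hf : f ∈ A.toSubring) (hf0 : f ≠ 0) :
    r ≤ ord A f ↔ MemPow A r f := by
  have hne : ∃ n, ¬ MemPow A n f := by
    by_contra! h
    have h1 : (⟨f, hf⟩ : A.toSubring) ∈ ⨅ n, maximalIdeal A.toSubring ^ n := by
      rw [Ideal.mem_iInf]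
      intro n
      obtain ⟨a, ha, haf⟩ := h n
      obtain rfl : a = ⟨f, hf⟩ := Subtype.ext haf
      exact ha
    rw [Ideal.iInf_pow_eq_bot_of_isLocalRing _ (maximalIdeal.isMaximal _).ne_top] at h1
    exact hf0 (congrArg Subtype.val h1)
  obtain ⟨n, hn⟩ := hne
  have hbdd : BddAbove {r : ℕ | MemPow A r f} :=
    ⟨n, fun r hr => not_lt.mp fun h => hn (MemPow.mono hr h.le)⟩
  refine ⟨fun h => ?_, fun h => le_csSup hbdd h⟩
  exact MemPow.mono (Nat.sSup_mem (s := {r : ℕ | MemPow A r f})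
    ⟨0, memPow_zero_iff.mpr hf⟩ hbdd) h

theorem memPow_ord [IsNoetherianRing A.toSubring] (hf : f ∈ A.toSubring) (hf0 : f ≠ 0) :
    MemPow A (ord A f) f := (le_ord_iff hf hf0).mp le_rfl

theorem ord_eq_zero_iff [IsNoetherianRing A.toSubring] (hf : f ∈ A.toSubring) (hf0 : f ≠ 0) :
    ord A f = 0 ↔ f⁻¹ ∈ A.toSubring := by
  rw [← not_iff_not, ← ne_eq, ← Nat.one_le_iff_ne_zero, le_ord_iff hf hf0, memPow_one_iff hf]
  simp [hf0]

theorem ord_mul [IsRegularLocalRing A.toSubring]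
    (hA : ∃ x ∈ maximalIdeal A.toSubring, x ∉ maximalIdeal A.toSubring ^ 2)
    (hf : f ∈ A.toSubring) (hf0 : f ≠ 0) (hg : g ∈ A.toSubring) (hg0 : g ≠ 0) :
    ord A (f * g) = ord A f + ord A g := by
  obtain ⟨x, hx, hx'⟩ := hA
  obtain ⟨S, hS⟩ := exists_isParameterSystem hx hx'
  have key (h : K) (hh : h ∈ A.toSubring) (hh0 : h ≠ 0) :
      ⟨h, hh⟩ ∈ maximalIdeal A.toSubring ^ ord A h ∧
      ⟨h, hh⟩ ∉ maximalIdeal A.toSubring ^ (ord A h + 1) := by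
    constructor
    · obtain ⟨a, ha, rfl⟩ := memPow_ord hh hh0
      exact ha
    · intro hmem
      have := (le_ord_iff hh hh0).mpr ⟨_, hmem, rfl⟩
      omega
  have h1 := hS.mul_notMem_pow (key f hf hf0).1 (key f hf hf0).2 (key g hg hg0).1 (key g hg hg0).2
  have hfg := mul_mem hf hg
  have hfg0 := mul_ne_zero hf0 hg0
  apply le_antisymm
  · by_contra! hlt
    obtain ⟨a, ha, haf⟩ := (le_ord_iff hfg hfg0).mp (Nat.succ_le_of_lt hlt)
    obtain rfl : a = ⟨f, hf⟩ * ⟨g, hg⟩ := Subtype.ext haf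
    exact h1 ha
  · exact (le_ord_iff hfg hfg0).mpr ((memPow_ord hf hf0).mul (memPow_ord hg hg0))

theorem ord_pow [IsRegularLocalRing A.toSubring]
    (hA : ∃ x ∈ maximalIdeal A.toSubring, x ∉ maximalIdeal A.toSubring ^ 2)
    (hf : f ∈ A.toSubring) (hf0 : f ≠ 0) (n : ℕ) : ord A (f ^ n) = n * ord A f := by
  induction n with
  | zero =>
    rw [pow_zero, zero_mul, ord_eq_zero_iff (one_mem _) one_ne_zero, inv_one]
    exact one_mem _
  | succ n ih => rw [pow_succ, ord_mul hA (pow_mem hf n) (pow_ne_zero n hf0) hf hf0, ih]; ring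

end Order

/-! ### One local quadratic transform. -/

section Step

variable {K : Type*} [Field K] {A B : LocalSubring K}

/-- The properties of a local quadratic transform `B` of a regular local ring `A` that concern
orders; the maximal ideal of `A` extends to the ideal of `B` generated by `x`. -/
structure IsStep (A B : LocalSubring K) (x : K) : Prop where
  le : A ≤ B
  ne_zero : x ≠ 0
  memPow : MemPow A 1 x
  not_memPow_two : ¬ MemPow A 2 x
  div_mem : ∀ ⦃k f⦄, MemPow A k f → f / x ^ k ∈ B.toSubring
  ord_div_le : ∀ ⦃f⦄, f ∈ A.toSubring → f ≠ 0 → ord B (f / x ^ ord A f) ≤ ord A f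
  exists_div : ∀ ⦃b⦄, b ∈ B.toSubring → ∃ k a c, MemPow A k a ∧ MemPow A k c ∧ c ≠ 0 ∧
    (c / x ^ k)⁻¹ ∈ B.toSubring ∧ b = a / c

theorem IsLocalQuadraticTransform.isRegularLocalRing_and_exists_isStep
    [IsRegularLocalRing A.toSubring] (h : IsLocalQuadraticTransform A B) :
    IsRegularLocalRing B.toSubring ∧ ∃ x, IsStep A B x := by
  obtain ⟨x₀, hx, hx', P, hP, hmP, rfl⟩ := h
  obtain ⟨S, hS⟩ := exists_isParameterSystem hx hx'
  have hx0 : (x₀ : K) ≠ 0 := by simpa using hS.ne_zero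
  set π := chartMap x₀ ((↑) : S → A.toSubring) with hπ
  have hmem (H) : π H ∈ chart A x₀ := hS.chart_eq_range ▸ ⟨H, rfl⟩
  have hex (b) (hb : b ∈ chart A x₀) : ∃ H, π H = b := by
    rw [hS.chart_eq_range] at hb
    exact hb
  obtain ⟨φ, hφ, hφH, hker⟩ := hS.exists_chart_hom
  set B := LocalSubring.ofPrime (chart A x₀) P with hB
  have hloc : IsLocalization.AtPrime B.toSubring P := inferInstance
  have hle : chart A x₀ ≤ B.toSubring := LocalSubring.le_ofPrime _ _
  have hxP : Subring.inclusion (le_chart A x₀) x₀ ∈ P := hmP (Ideal.mem_map_of_mem _ hx)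
  have hkerP : RingHom.ker φ ≤ P := by
    rw [hker, Ideal.span_singleton_le_iff_mem]
    exact hxP
  obtain ⟨Q, hQ, ψ, hψ, hψφ, hψker⟩ := exists_surjective_localization (B := B.toSubring) P φ hφ hkerP
  have hchartN : IsNoetherianRing (chart A x₀) := by
    rw [hS.chart_eq_range]
    exact isNoetherianRing_range _
  have hBN : IsNoetherianRing B.toSubring :=
    IsLocalization.isNoetherianRing P.primeCompl _ hchartN
  have hreg : IsRegularLocalRing B.toSubring := by
    rw [hker, Ideal.map_span, Set.image_singleton] at hψker
    refine isRegularLocalRing_of_surjective ψ hψ ?_ hψker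
    intro h0
    exact hx0 (congrArg Subtype.val h0)
  refine ⟨hreg, x₀, ⟨(le_chart A x₀).trans hle, ?_⟩, hx0, ⟨x₀, by simpa using hx, rfl⟩, ?_, ?_,
    ?_, ?_⟩
  · refine ((local_hom_TFAE _).out 2 0).mp ?_
    rw [Ideal.map_le_iff_le_comap]
    intro a ha
    exact (IsLocalization.AtPrime.to_map_mem_maximal_iff B.toSubring P
      (Subring.inclusion (le_chart A x₀) a)).mpr (hmP (Ideal.mem_map_of_mem _ ha))
  · rintro ⟨a, ha, hax⟩
    obtain rfl : a = x₀ := Subtype.ext hax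
    exact hx' ha
  · rintro k _ ⟨a, ha, rfl⟩
    obtain ⟨H, -, hH⟩ := hS.exists_chartMap ha
    rw [hH, mul_div_cancel_left₀ _ (pow_ne_zero _ hx0)]
    exact hle (hmem H)
  · intro f hf hf0
    -- The strict transform is `π H` with `H` of degree at most `r` and nonzero modulo `𝔪`. Order
    -- above `r` in `B` would survive in the localized polynomial ring and contradict the degree
    -- bound at `Q`.
    by_contra! hlt
    obtain ⟨a, ha, rfl⟩ := memPow_ord hf hf0
    set r := ord A (a : K) with hr
    obtain ⟨H, hHr, hH⟩ := hS.exists_chartMap ha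
    have hdiv : (a : K) / x₀ ^ r = π H := by
      rw [hH, mul_div_cancel_left₀ _ (pow_ne_zero _ hx0)]
    rw [hdiv] at hlt
    have hHmap : H.map (residue A.toSubring) ≠ 0 := by
      intro h0
      obtain ⟨a', -, ha', ha''⟩ := hS.exists_mem_pow hHr
      obtain rfl : a' = a := Subtype.ext (ha'.trans hH.symm)
      have := (le_ord_iff hf hf0).mpr ⟨_, ha''.mp h0, rfl⟩
      omega
    have hπ0 : π H ≠ 0 := by
      rw [← hdiv]
      exact div_ne_zero hf0 (pow_ne_zero _ hx0)
    obtain ⟨b, hb, hbH⟩ := (le_ord_iff (hle (hmem H)) hπ0).mp (Nat.succ_le_of_lt hlt)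
    obtain rfl : b = algebraMap (chart A x₀) B.toSubring ⟨π H, hmem H⟩ := Subtype.ext hbH
    have hψloc : IsLocalHom ψ := .of_surjective ψ hψ
    have h1 : (maximalIdeal B.toSubring).map ψ ≤ maximalIdeal (Localization.AtPrime Q) :=
      ((local_hom_TFAE _).out 0 2).mp hψloc
    have h2 := Ideal.mem_map_of_mem ψ hb
    rw [Ideal.map_pow] at h2
    have h3 := Ideal.pow_right_mono h1 _ h2
    rw [hψφ, hφH H _ rfl, ← Localization.AtPrime.map_eq_maximalIdeal, ← Ideal.map_pow,
      IsLocalization.algebraMap_mem_map_algebraMap_iff Q.primeCompl] at h3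
    obtain ⟨s, hs, hsH⟩ := h3
    refine hHmap (eq_zero_of_mul_mem_pow_of_totalDegree_lt Q hs ?_ hsH)
    refine Nat.lt_succ_of_le (le_trans ?_ hHr)
    exact Finset.sup_mono (MvPolynomial.support_map_subset _ _)
  · intro b hb
    obtain ⟨p, s, hps⟩ := IsLocalization.exists_mk'_eq P.primeCompl (⟨b, hb⟩ : B.toSubring)
    have hs0 : ((s : chart A x₀) : K) ≠ 0 := fun h0 => s.2 (by
      obtain h1 : (s : chart A x₀) = 0 := Subtype.ext h0
      rw [h1]; exact zero_mem _)
    have hbps : b * ((s : chart A x₀) : K) = (p : K) := by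
      have := IsLocalization.mk'_spec B.toSubring p s
      rw [hps] at this
      exact congrArg Subtype.val this
    obtain ⟨H, hH⟩ := hex p p.2
    obtain ⟨G, hG⟩ := hex s (s : chart A x₀).2
    -- A common exponent lets `x₀ ^ k` clear both denominators at once.
    set k := max H.totalDegree G.totalDegree with hk
    obtain ⟨a, ha, haH, -⟩ := hS.exists_mem_pow (le_max_left _ _ : _ ≤ k)
    obtain ⟨c, hc, hcG, -⟩ := hS.exists_mem_pow (le_max_right _ _ : _ ≤ k)
    have haH' : (a : K) = x₀ ^ k * p := by rw [haH, ← hH]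
    have hcG' : (c : K) = x₀ ^ k * (s : chart A x₀) := by rw [hcG, ← hG]
    have hxk := pow_ne_zero k hx0
    refine ⟨k, a, c, ⟨a, ha, rfl⟩, ⟨c, hc, rfl⟩, ?_, ?_, ?_⟩
    · rw [hcG']
      exact mul_ne_zero hxk hs0
    · rw [hcG', mul_div_cancel_left₀ _ hxk]
      obtain ⟨t, ht⟩ := (IsLocalization.map_units B.toSubring s).exists_right_inv
      have ht' : ((s : chart A x₀) : K) * t = 1 := congrArg Subtype.val ht
      rw [← eq_inv_of_mul_eq_one_right ht']
      exact t.2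
    · rw [haH', hcG', mul_div_mul_left _ _ hxk, ← hbps, mul_div_cancel_right₀ _ hs0]

end Step
-- Elements whose strict transforms become units.
section Sequence

variable {K : Type*} [Field K]

section IsStep

variable {A B : LocalSubring K} {x f : K}

theorem IsStep.exists_mem (h : IsStep A B x) :
    ∃ x ∈ maximalIdeal A.toSubring, x ∉ maximalIdeal A.toSubring ^ 2 := by
  obtain ⟨a, ha, rfl⟩ := h.memPow
  exact ⟨a, by simpa using ha, fun h' => h.not_memPow_two ⟨a, h', rfl⟩⟩

theorem IsStep.mem (h : IsStep A B x) : x ∈ A.toSubring := h.memPow.mem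

theorem IsStep.ord_eq_one [IsNoetherianRing A.toSubring] (h : IsStep A B x) : ord A x = 1 := by
  have h1 := (le_ord_iff h.mem h.ne_zero).mpr h.memPow
  have h2 := mt (le_ord_iff h.mem h.ne_zero).mp h.not_memPow_two
  omega

theorem IsStep.memPow_right (h : IsStep A B x) : MemPow B 1 x := h.memPow.of_le h.le

theorem IsStep.div_pow_ord_mem [IsNoetherianRing A.toSubring] (h : IsStep A B x)
    (hf : f ∈ A.toSubring) (hf0 : f ≠ 0) : f / x ^ ord A f ∈ B.toSubring :=
  h.div_mem (memPow_ord hf hf0)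

/-- If `c / x ^ k` is a unit of the transform, then `k` is the order of `c`. -/
theorem IsStep.ord_eq_of_inv_mem [IsNoetherianRing A.toSubring] (h : IsStep A B x) {k : ℕ} {c : K}
    (hc : MemPow A k c) (hc0 : c ≠ 0) (hinv : (c / x ^ k)⁻¹ ∈ B.toSubring) : ord A c = k := by
  apply le_antisymm _ ((le_ord_iff hc.mem hc0).mpr hc)
  by_contra! hlt
  have h1 := h.div_mem ((le_ord_iff hc.mem hc0).mp (Nat.succ_le_of_lt hlt))
  have h2 : MemPow B 1 (c / x ^ k) := by
    have h3 := h.memPow_right.mul (memPow_zero_iff.mpr h1)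
    have h4 : x * (c / x ^ k.succ) = c / x ^ k := by
      rw [Nat.succ_eq_add_one, pow_succ', ← mul_div_assoc, mul_div_mul_left _ _ h.ne_zero]
    rwa [h4] at h3
  have h5 := (memPow_one_iff (h.div_mem hc)).mp h2
  exact h5.elim (div_ne_zero hc0 (pow_ne_zero _ h.ne_zero)) (fun h => h hinv)

end IsStep

/-- Some iterated strict transform of `b`, an element of the `n`-th ring, is a unit. -/
inductive EventuallyUnit (R : ℕ → LocalSubring K) (x : ℕ → K) : ℕ → K → Prop
  | unit {n : ℕ} {b : K} : b ∈ (R n).toSubring → b⁻¹ ∈ (R n).toSubring → b ≠ 0 →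
      EventuallyUnit R x n b
  | step {n : ℕ} {b : K} : b ∈ (R n).toSubring → b ≠ 0 →
      EventuallyUnit R x (n + 1) (b / x n ^ ord (R n) b) → EventuallyUnit R x n b

variable {R : ℕ → LocalSubring K} {x : ℕ → K}

namespace EventuallyUnit

variable {n : ℕ} {b c : K}

theorem mem (h : EventuallyUnit R x n b) : b ∈ (R n).toSubring := by
  cases h <;> assumption

theorem ne_zero (h : EventuallyUnit R x n b) : b ≠ 0 := by
  cases h <;> assumption

theorem one (n : ℕ) : EventuallyUnit R x n 1 :=
  .unit (one_mem _) (by rw [inv_one]; exact one_mem _) one_ne_zero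

variable (hreg : ∀ n, IsRegularLocalRing (R n).toSubring)
  (hstep : ∀ n, IsStep (R n) (R (n + 1)) (x n))

include hreg hstep

theorem next (h : EventuallyUnit R x n b) :
    EventuallyUnit R x (n + 1) (b / x n ^ ord (R n) b) := by
  cases h with
  | unit hb hb' hb0 =>
    rw [(ord_eq_zero_iff hb hb0).mpr hb', pow_zero, div_one]
    exact .unit ((hstep n).le.1 hb) ((hstep n).le.1 hb') hb0
  | step hb hb0 h => exact h

theorem strictTransform_mul (hb : b ∈ (R n).toSubring) (hb0 : b ≠ 0) (hc : c ∈ (R n).toSubring)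
    (hc0 : c ≠ 0) : b * c / x n ^ ord (R n) (b * c) =
      b / x n ^ ord (R n) b * (c / x n ^ ord (R n) c) := by
  rw [ord_mul (hstep n).exists_mem hb hb0 hc hc0, pow_add, mul_div_mul_comm]

theorem mul (hb : EventuallyUnit R x n b) (hc : EventuallyUnit R x n c) :
    EventuallyUnit R x n (b * c) := by
  induction hb generalizing c with
  | unit hb hb' hb0 =>
    induction hc with
    | unit hc hc' hc0 =>
      exact .unit (mul_mem hb hc) (by rw [mul_inv]; exact mul_mem hb' hc') (mul_ne_zero hb0 hc0)
    | @step n c hc hc0 _ ih =>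
      refine .step (mul_mem hb hc) (mul_ne_zero hb0 hc0) ?_
      rw [strictTransform_mul hreg hstep hb hb0 hc hc0, (ord_eq_zero_iff hb hb0).mpr hb',
        pow_zero, div_one]
      exact ih ((hstep n).le.1 hb) ((hstep n).le.1 hb')
  | step hb hb0 _ ih =>
    refine .step (mul_mem hb hc.mem) (mul_ne_zero hb0 hc.ne_zero) ?_
    rw [strictTransform_mul hreg hstep hb hb0 hc.mem hc.ne_zero]
    exact ih (hc.next hreg hstep)

theorem pow (hb : EventuallyUnit R x n b) (k : ℕ) : EventuallyUnit R x n (b ^ k) := by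
  induction k with
  | zero => rw [pow_zero]; exact one n
  | succ k ih => rw [pow_succ]; exact ih.mul hreg hstep hb

/-- Strict transforms are multiplicative and a factor of a unit is a unit; this is the saturation of
the multiplicative set. -/
theorem of_mul_right (h : EventuallyUnit R x n (b * c)) (hb : b ∈ (R n).toSubring)
    (hc : c ∈ (R n).toSubring) : EventuallyUnit R x n c := by
  generalize hz : b * c = z at h
  induction h generalizing b c with
  | unit _ hz' hz0 =>
    subst hz
    refine .unit hc ?_ (right_ne_zero_of_mul hz0)
    have : c⁻¹ = b * (b * c)⁻¹ := by
      have := left_ne_zero_of_mul hz0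
      have := right_ne_zero_of_mul hz0
      field_simp
    rw [this]
    exact mul_mem hb hz'
  | @step n z _ hz0 _ ih =>
    subst hz
    have hb0 := left_ne_zero_of_mul hz0
    have hc0 := right_ne_zero_of_mul hz0
    exact .step hc hc0 (ih ((hstep n).div_pow_ord_mem hb hb0) ((hstep n).div_pow_ord_mem hc hc0)
      (strictTransform_mul hreg hstep hb hb0 hc hc0).symm)

theorem base (n : ℕ) : EventuallyUnit R x n (x n) := by
  refine .step (hstep n).mem (hstep n).ne_zero ?_
  rw [(hstep n).ord_eq_one, pow_one, div_self (hstep n).ne_zero]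
  exact one _

/-- A denominator of a fraction representing an element of the transform. -/
theorem of_inv_mem {k : ℕ} (hc : MemPow (R n) k c) (hc0 : c ≠ 0)
    (hinv : (c / x n ^ k)⁻¹ ∈ (R (n + 1)).toSubring) : EventuallyUnit R x n c := by
  refine .step hc.mem hc0 ?_
  rw [(hstep n).ord_eq_of_inv_mem hc hc0 hinv]
  exact .unit ((hstep n).div_mem hc) hinv (div_ne_zero hc0 (pow_ne_zero _ (hstep n).ne_zero))

theorem exists_div_of_succ (h : EventuallyUnit R x (n + 1) b) :
    ∃ y s, EventuallyUnit R x n y ∧ EventuallyUnit R x n s ∧ b = y / s := by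
  obtain ⟨k, a, c, ha, hc, hc0, hinv, rfl⟩ := (hstep n).exists_div h.mem
  have hx0 := (hstep n).ne_zero
  have ha0 : a ≠ 0 := fun h0 => h.ne_zero (by rw [h0, zero_div])
  refine ⟨a, c, ?_, of_inv_mem hreg hstep hc hc0 hinv, rfl⟩
  refine .step ha.mem ha0 ?_
  have hle := (le_ord_iff ha.mem ha0).mpr ha
  have h1 : EventuallyUnit R x (n + 1) (c / x n ^ k) :=
    .unit ((hstep n).div_mem hc) hinv (div_ne_zero hc0 (pow_ne_zero _ hx0))
  have h2 := h.mul hreg hstep h1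
  -- Up to the unit `c / x n ^ k`, the given element is a multiple of the strict transform of the
  -- numerator `a`, so saturation applies.
  have h3 : a / c * (c / x n ^ k) = x n ^ (ord (R n) a - k) * (a / x n ^ ord (R n) a) := by
    rw [div_mul_div_cancel₀ hc0, ← mul_div_assoc, mul_comm, mul_div_assoc, pow_sub₀ _ hx0 hle]
    field_simp
  rw [h3] at h2
  exact of_mul_right hreg hstep h2 (pow_mem ((hstep n).le.1 (hstep n).mem) _)
    ((hstep n).div_pow_ord_mem ha.mem ha0)

theorem exists_div_of_add {j : ℕ} (i : ℕ) {b : K} (h : EventuallyUnit R x (j + i) b) :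
    ∃ y s, EventuallyUnit R x j y ∧ EventuallyUnit R x j s ∧ b = y / s := by
  induction i generalizing b with
  | zero => exact ⟨b, 1, h, one j, (div_one b).symm⟩
  | succ i ih =>
    obtain ⟨y, s, hy, hs, rfl⟩ := exists_div_of_succ hreg hstep h
    obtain ⟨y₁, y₂, h1, h2, rfl⟩ := ih hy
    obtain ⟨s₁, s₂, h3, h4, rfl⟩ := ih hs
    exact ⟨y₁ * s₂, y₂ * s₁, h1.mul hreg hstep h4, h2.mul hreg hstep h3,
      div_div_div_eq _ _ _ _⟩

/-- The rings of the sequence are contained in localizations of the earlier ones. -/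
theorem exists_div_of_mem {j : ℕ} (i : ℕ) {b : K} (hb : b ∈ (R (j + i)).toSubring) :
    ∃ y s, y ∈ (R j).toSubring ∧ EventuallyUnit R x j s ∧ b = y / s := by
  induction i generalizing b with
  | zero => exact ⟨b, 1, hb, one j, (div_one b).symm⟩
  | succ i ih =>
    obtain ⟨k, a, c, ha, hc, hc0, hinv, rfl⟩ := (hstep (j + i)).exists_div hb
    obtain ⟨y, s, hy, hs, rfl⟩ := ih ha.mem
    obtain ⟨c₁, c₂, h1, h2, rfl⟩ := exists_div_of_add hreg hstep i
      (of_inv_mem hreg hstep hc hc0 hinv)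
    exact ⟨y * c₂, s * c₁, mul_mem hy h2.mem, hs.mul hreg hstep h1, div_div_div_eq _ _ _ _⟩

omit hreg hstep in
theorem false_of_strictTransform {f : ℕ → K} (h : EventuallyUnit R x n (f n))
    (hf : ∀ i, n ≤ i → f (i + 1) = f i / x i ^ ord (R i) (f i))
    (hf' : ∀ i, n ≤ i → (f i)⁻¹ ∉ (R i).toSubring) : False := by
  generalize hz : f n = z at h
  induction h with
  | unit _ hz' _ => exact hf' _ le_rfl (hz ▸ hz')
  | @step n z _ _ _ ih =>
    refine ih (fun i hi => hf i (by omega)) (fun i hi => hf' i (by omega)) ?_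
    rw [hf n le_rfl, hz]

end EventuallyUnit

theorem monotone_of_isStep (hstep : ∀ n, IsStep (R n) (R (n + 1)) (x n)) : Monotone R :=
  monotone_nat_of_le_succ fun n => (hstep n).le

theorem SwitchesStronglyInfinitelyOften.eventuallyUnit
    (hreg : ∀ n, IsRegularLocalRing (R n).toSubring)
    (hstep : ∀ n, IsStep (R n) (R (n + 1)) (x n)) (hR : SwitchesStronglyInfinitelyOften R)
    {j : ℕ} {b : K} (hb : b ∈ (R j).toSubring) (hb0 : b ≠ 0) : EventuallyUnit R x j b := by
  classical
  have hmono := monotone_of_isStep hstep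
  by_cases hu : b⁻¹ ∈ (R j).toSubring
  · exact .unit hb hu hb0
  -- If `p` contained no eventual unit, all denominators over `R j` would be invertible at `p`, and
  -- the whole sequence would lie in the localization at `p`.
  have key (p : Ideal (R j).toSubring) (hp : p.IsPrime) (hht : p.height = 1) :
      ∃ s ∈ p, EventuallyUnit R x j (s : K) := by
    by_contra! hno
    refine hR ⟨j, p, hp, hht, fun n z hz => ?_⟩
    have hz' : z ∈ (R (j + n)).toSubring := (hmono (Nat.le_add_left n j)).1 hz
    obtain ⟨y, s, hy, hs, rfl⟩ := EventuallyUnit.exists_div_of_mem hreg hstep n hz'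
    have hsp : (⟨s, hs.mem⟩ : (R j).toSubring) ∈ p.primeCompl := fun h => hno _ h hs
    obtain ⟨t, ht⟩ := (IsLocalization.map_units
      (LocalSubring.ofPrime (R j).toSubring p).toSubring
      (⟨_, hsp⟩ : p.primeCompl)).exists_right_inv
    have ht' : s * (t : K) = 1 := congrArg Subtype.val ht
    rw [div_eq_mul_inv, ← eq_inv_of_mul_eq_one_right ht']
    exact mul_mem (LocalSubring.le_ofPrime _ _ hy) t.2
  set b' : (R j).toSubring := ⟨b, hb⟩ with hb'
  have hb'0 : b' ≠ 0 := fun h => hb0 (congrArg Subtype.val h)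
  have hb'u : ¬ IsUnit b' := by
    intro h
    obtain ⟨c, hc⟩ := h.exists_right_inv
    refine hu ?_
    have : b * (c : K) = 1 := congrArg Subtype.val hc
    rw [← eq_inv_of_mul_eq_one_right this]
    exact c.2
  have hfin := Ideal.finite_minimalPrimes_of_isNoetherianRing (R j).toSubring (Ideal.span {b'})
  have hmin : ∀ p ∈ (Ideal.span {b'}).minimalPrimes, ∃ s ∈ p, EventuallyUnit R x j (s : K) := by
    intro p hp
    have := hp.1.1
    refine key p hp.1.1 (le_antisymm
      (Ideal.height_le_one_of_isPrincipal_of_mem_minimalPrimes _ p hp) ?_)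
    rw [Order.one_le_iff_pos, pos_iff_ne_zero, ne_eq, Ideal.height_eq_zero_iff_eq_bot]
    rintro rfl
    exact hb'0 (hp.1.2 (Ideal.mem_span_singleton_self b'))
  -- The product of one eventual unit from each minimal prime of `(b)` lies in the radical of `(b)`.
  -- A power of it is a multiple of `b`, and saturation concludes.
  choose! s hsp hs using hmin
  set t : (R j).toSubring := ∏ p ∈ hfin.toFinset, s p with ht
  have htE : EventuallyUnit R x j (t : K) := by
    have : ∀ S : Finset (Ideal (R j).toSubring), (∀ p ∈ S, p ∈ (Ideal.span {b'}).minimalPrimes) →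
        EventuallyUnit R x j ((∏ p ∈ S, s p : (R j).toSubring) : K) := by
      intro S
      induction S using Finset.induction_on with
      | empty => intro _; simpa using EventuallyUnit.one j
      | insert p S hpS ih =>
        intro h
        rw [Finset.prod_insert hpS, Subring.coe_mul]
        exact (hs p (h p (Finset.mem_insert_self p S))).mul hreg hstep
          (ih fun q hq => h q (Finset.mem_insert_of_mem hq))
    exact this _ fun p hp => by simpa using hp
  have htrad : t ∈ (Ideal.span {b'}).radical := by
    rw [← Ideal.sInf_minimalPrimes, Ideal.mem_sInf]
    intro p hp
    exact Ideal.mem_of_dvd _ (Finset.dvd_prod_of_mem s (by simpa using hp)) (hsp p hp)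
  obtain ⟨N, hN⟩ := htrad
  obtain ⟨c, hc⟩ := Ideal.mem_span_singleton'.mp hN
  have h1 := htE.pow hreg hstep N
  rw [← SubmonoidClass.coe_pow, ← hc, Subring.coe_mul] at h1
  exact h1.of_mul_right hreg hstep c.2 hb

end Sequence
-- The union: valuation ring, dimension one, real valuation and limit.
section Union

variable {K : Type*} [Field K] {R : ℕ → LocalSubring K} {x : ℕ → K}

/-- Once the minimum is constantly `c`, an entry that attains it is divided by exactly its own power
of `x n`. Its order then cannot rise above `c`, nor fall below the minimum. -/
theorem ord_eq_of_min_eq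
    (hstep : ∀ n, IsStep (R n) (R (n + 1)) (x n)) {f : ℕ → K} {r s : ℕ → ℕ} {N c : ℕ}
    (hf : ∀ n, f n ∈ (R n).toSubring) (hf0 : ∀ n, f n ≠ 0)
    (hr : ∀ n, r n = min (ord (R n) (f n)) (s n)) (hrec : ∀ n, f (n + 1) = f n / x n ^ r n)
    (hc : ∀ n, N ≤ n → r n = c) (hN : ord (R N) (f N) = c) :
    ∀ n, N ≤ n → ord (R n) (f n) = c := by
  intro n hn
  induction n, hn using Nat.le_induction with
  | base => exact hN
  | succ n hn ih =>
    apply le_antisymm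
    · have h1 := (hstep n).ord_div_le (hf n) (hf0 n)
      rwa [ih, ← hc n hn, ← hrec n, hc n hn] at h1
    · rw [← hc (n + 1) (hn.trans n.le_succ), hr]
      exact min_le_left _ _

theorem exists_mem_or_inv_mem [IsFractionRing (R 0).toSubring K]
    (hreg : ∀ n, IsRegularLocalRing (R n).toSubring)
    (hstep : ∀ n, IsStep (R n) (R (n + 1)) (x n)) (hR : SwitchesStronglyInfinitelyOften R)
    (z : K) : ∃ n, z ∈ (R n).toSubring ∨ z⁻¹ ∈ (R n).toSubring := by
  classical
  by_contra! hz
  have hz0 : z ≠ 0 := fun h => (hz 0).1 (h ▸ zero_mem _)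
  obtain ⟨a, b, -, hab⟩ := IsFractionRing.div_surjective (A := (R 0).toSubring) z
  change (a : K) / (b : K) = z at hab
  obtain ⟨ha0, hb0⟩ : (a : K) ≠ 0 ∧ (b : K) ≠ 0 := by
    rw [← div_ne_zero_iff, hab]
    exact hz0
  let m (n : ℕ) (p : K × K) : ℕ := min (ord (R n) p.1) (ord (R n) p.2)
  -- Both entries are divided by the same power of `x n`, so the quotient stays `z`; neither can
  -- become a unit while `z` and `z⁻¹` lie outside every ring.
  let P : ℕ → K × K := fun n => Nat.rec ((a : K), (b : K))
    (fun n p => (p.1 / x n ^ m n p, p.2 / x n ^ m n p)) n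
  have hP (n) : P (n + 1) = ((P n).1 / x n ^ m n (P n), (P n).2 / x n ^ m n (P n)) := rfl
  have hinv (n) : (P n).1 ∈ (R n).toSubring ∧ (P n).2 ∈ (R n).toSubring ∧ (P n).1 ≠ 0 ∧
      (P n).2 ≠ 0 ∧ (P n).1 / (P n).2 = z := by
    induction n with
    | zero => exact ⟨a.2, b.2, ha0, hb0, hab⟩
    | succ n ih =>
      obtain ⟨h1, h2, h3, h4, h5⟩ := ih
      have hx := pow_ne_zero (m n (P n)) (hstep n).ne_zero
      rw [hP]
      exact ⟨(hstep n).div_mem ((le_ord_iff h1 h3).mp (min_le_left _ _)),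
        (hstep n).div_mem ((le_ord_iff h2 h4).mp (min_le_right _ _)),
        div_ne_zero h3 hx, div_ne_zero h4 hx, by rw [div_div_div_cancel_right₀ hx, h5]⟩
  have hnu (n) : (P n).1⁻¹ ∉ (R n).toSubring ∧ (P n).2⁻¹ ∉ (R n).toSubring := by
    obtain ⟨h1, h2, h3, h4, h5⟩ := hinv n
    constructor
    · intro h
      refine (hz n).2 ?_
      rw [← h5, inv_div, div_eq_mul_inv]
      exact mul_mem h2 h
    · intro h
      refine (hz n).1 ?_
      rw [← h5, div_eq_mul_inv]
      exact mul_mem h1 h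
  let r : ℕ → ℕ := fun n => m n (P n)
  have hanti : Antitone r := by
    refine antitone_nat_of_succ_le fun n => ?_
    obtain ⟨h1, h2, h3, h4, -⟩ := hinv n
    have h6 : (P (n + 1)).1 = (P n).1 / x n ^ r n := by rw [hP]
    have h7 : (P (n + 1)).2 = (P n).2 / x n ^ r n := by rw [hP]
    rcases min_choice (ord (R n) (P n).1) (ord (R n) (P n).2) with h | h
    · have h8 : r n = ord (R n) (P n).1 := h
      refine (min_le_left _ _).trans ?_
      rw [h6, h8]
      exact (hstep n).ord_div_le h1 h3
    · have h8 : r n = ord (R n) (P n).2 := h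
      refine (min_le_right _ _).trans ?_
      rw [h7, h8]
      exact (hstep n).ord_div_le h2 h4
  obtain ⟨N, hN⟩ : ∃ N, ∀ n, N ≤ n → r n = r N := by
    obtain ⟨_, ⟨N, rfl⟩, hmin⟩ := wellFounded_lt.has_min (Set.range r) ⟨_, 0, rfl⟩
    exact ⟨N, fun n hn => le_antisymm (hanti hn) (not_lt.mp (hmin _ ⟨n, rfl⟩))⟩
  rcases min_choice (ord (R N) (P N).1) (ord (R N) (P N).2) with h | h
  · have h8 : r N = ord (R N) (P N).1 := h
    have h9 := ord_eq_of_min_eq (f := fun n => (P n).1) (r := r)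
      (s := fun n => ord (R n) (P n).2) hstep (fun n => (hinv n).1)
      (fun n => (hinv n).2.2.1) (fun n => rfl) (fun n => by rw [hP]) hN h8.symm
    refine EventuallyUnit.false_of_strictTransform (f := fun n => (P n).1)
      (hR.eventuallyUnit hreg hstep (hinv N).1 (hinv N).2.2.1) (fun i hi => ?_)
      (fun i _ => (hnu i).1)
    rw [h9 i hi, ← hN i hi, hP]
  · have h8 : r N = ord (R N) (P N).2 := h
    have h9 := ord_eq_of_min_eq (f := fun n => (P n).2) (r := r)
      (s := fun n => ord (R n) (P n).1) hstep (fun n => (hinv n).2.1)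
      (fun n => (hinv n).2.2.2.1) (fun n => min_comm _ _) (fun n => by rw [hP]) hN h8.symm
    refine EventuallyUnit.false_of_strictTransform (f := fun n => (P n).2)
      (hR.eventuallyUnit hreg hstep (hinv N).2.1 (hinv N).2.2.2.1) (fun i hi => ?_)
      (fun i _ => (hnu i).2)
    rw [h9 i hi, ← hN i hi, hP]

/-- Each step splits off `x n ^ ord b` from `b`, and `x n` divides `y` in the next ring; extra
powers of `y` absorb these factors until a unit remains. -/
theorem EventuallyUnit.exists_pow_eq_mul (hstep : ∀ n, IsStep (R n) (R (n + 1)) (x n))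
    {V : Subring K} (hV : ∀ n, (R n).toSubring ≤ V) {n : ℕ} {b : K}
    (h : EventuallyUnit R x n b) {y : K} (hy : MemPow (R n) 1 y) :
    ∃ k, ∃ c ∈ V, y ^ k = b * c := by
  induction h with
  | unit _ hb' hb0 => exact ⟨0, _, hV _ hb', by rw [pow_zero, mul_inv_cancel₀ hb0]⟩
  | @step n b hb hb0 _ ih =>
    obtain ⟨k, c, hc, hk⟩ := ih (hy.of_le (hstep n).le)
    have hyx := hV _ ((hstep n).div_mem hy)
    have hx0 := (hstep n).ne_zero
    rw [pow_one] at hyx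
    refine ⟨k + ord (R n) b, c * (y / x n) ^ ord (R n) b, mul_mem hc (pow_mem hyx _), ?_⟩
    rw [pow_add, hk, div_pow]
    field_simp

/-- The hypothesis says that the value group is archimedean, so Hölder's theorem embeds it in `ℝ`.
The sign is reversed to pass from multiplicative to additive valuations. -/
theorem exists_isAssociated {V : ValuationSubring K}
    (hV : ∀ a ∉ V, ∀ b : K, ∃ n : ℕ, b / a ^ n ∈ V) :
    ∃ v : AddValuation K (WithTop ℝ), IsAssociated v V := by
  classical
  have hval (a : K) : V.valuation a ≤ 1 ↔ a ∈ V := V.valuation_le_one_iff a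
  have harch : MulArchimedean (V.ValueGroup)ˣ := by
    refine ⟨fun u w hw => ?_⟩
    obtain ⟨a, ha⟩ := V.valuation_surjective w
    obtain ⟨b, hb⟩ := V.valuation_surjective u
    have haV : a ∉ V := by
      rw [← hval, ha, not_le]
      exact_mod_cast hw
    obtain ⟨n, hn⟩ := hV a haV b
    refine ⟨n, ?_⟩
    rw [← hval, map_div₀, map_pow, ha, hb] at hn
    rw [← Units.val_le_val, Units.val_pow_eq_pow_val]
    exact (div_le_one₀ (pow_pos (zero_lt_iff.mpr w.ne_zero) n)).mp hn
  obtain ⟨e, he⟩ := Archimedean.exists_orderAddMonoidHom_real_injective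
    (Additive (V.ValueGroup)ˣ)
  have hmono : StrictMono e := e.monotone'.strictMono_of_injective he
  have hne {z : K} (hz : z ≠ 0) : V.valuation z ≠ 0 := (V.valuation.ne_zero_iff).mpr hz
  let w (z : K) : WithTop ℝ := if hz : z = 0 then ⊤ else
    ((-e (Additive.ofMul (Units.mk0 _ (hne hz))) : ℝ) : WithTop ℝ)
  have hw0 : w 0 = ⊤ := dif_pos rfl
  have hw {z : K} (hz : z ≠ 0) :
      w z = ((-e (Additive.ofMul (Units.mk0 _ (hne hz))) : ℝ) : WithTop ℝ) := dif_neg hz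
  have hle {y z : K} (hy : y ≠ 0) (h : V.valuation z ≤ V.valuation y) : w y ≤ w z := by
    by_cases hz : z = 0
    · rw [hz, hw0]; exact le_top
    · rw [hw hy, hw hz, WithTop.coe_le_coe, neg_le_neg_iff, hmono.le_iff_le]
      exact h
  have hw1 : w 1 = 0 := by
    rw [hw one_ne_zero]
    have : Units.mk0 _ (hne (one_ne_zero (α := K))) = (1 : (V.ValueGroup)ˣ) :=
      Units.ext (map_one _)
    rw [this, ofMul_one, map_zero, neg_zero]
    rfl
  refine ⟨AddValuation.of w hw0 hw1 ?_ ?_, ?_⟩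
  · intro y z
    by_cases hyz : y + z = 0
    · rw [hyz, hw0]; exact le_top
    by_cases hy : y = 0
    · rw [hy, zero_add]; exact min_le_right _ _
    by_cases hz : z = 0
    · rw [hz, add_zero]; exact min_le_left _ _
    rcases le_max_iff.mp (V.valuation.map_add y z) with h | h
    · exact (min_le_left _ _).trans (hle hy h)
    · exact (min_le_right _ _).trans (hle hz h)
  · intro y z
    by_cases hy : y = 0
    · rw [hy, zero_mul, hw0, WithTop.top_add]
    by_cases hz : z = 0
    · rw [hz, mul_zero, hw0, WithTop.add_top]
    rw [hw hy, hw hz, hw (mul_ne_zero hy hz), ← WithTop.coe_add, WithTop.coe_inj, ← neg_add,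
      neg_inj, ← map_add, ← ofMul_mul]
    congr 2
    exact Units.ext (map_mul _ _ _)
  · intro z
    rw [AddValuation.of_apply]
    by_cases hz : z = 0
    · rw [hz, hw0]
      exact ⟨fun _ => le_top, fun _ => zero_mem V⟩
    · rw [hw hz, ← hval, ← WithTop.coe_zero, WithTop.coe_le_coe, Left.nonneg_neg_iff, ← map_zero e,
        hmono.le_iff_le]
      rfl

variable {V : ValuationSubring K} {v : AddValuation K (WithTop ℝ)}

/-- The default value `0` is never used at nonzero elements, whose values are finite. -/
theorem coe_untopD (v : AddValuation K (WithTop ℝ)) {z : K} (hz : z ≠ 0) :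
    (((v z).untopD 0 : ℝ) : WithTop ℝ) = v z := by
  lift v z to ℝ using (v.ne_top_iff.mpr hz) with a
  rfl

theorem untopD_mul (v : AddValuation K (WithTop ℝ)) {y z : K} (hy : y ≠ 0) (hz : z ≠ 0) :
    (v (y * z)).untopD 0 = (v y).untopD 0 + (v z).untopD 0 := by
  rw [← WithTop.coe_inj, WithTop.coe_add, coe_untopD v hy, coe_untopD v hz,
    coe_untopD v (mul_ne_zero hy hz), AddValuation.map_mul]

theorem untopD_pow (v : AddValuation K (WithTop ℝ)) {y : K} (hy : y ≠ 0) (n : ℕ) :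
    (v (y ^ n)).untopD 0 = n * (v y).untopD 0 := by
  induction n with
  | zero => rw [pow_zero, AddValuation.map_one, Nat.cast_zero, zero_mul]; rfl
  | succ n ih => rw [pow_succ, untopD_mul v (pow_ne_zero n hy) hy, ih]; push_cast; ring

theorem IsAssociated.mem_iff (hv : IsAssociated v V) {z : K} (hz : z ≠ 0) :
    z ∈ V ↔ 0 ≤ (v z).untopD 0 := by
  rw [hv z, ← coe_untopD v hz, ← WithTop.coe_zero, WithTop.coe_le_coe, WithTop.untopD_coe]

theorem IsAssociated.pos_iff (hv : IsAssociated v V) {z : K} (hz : z ≠ 0) :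
    z⁻¹ ∉ V ↔ 0 < (v z).untopD 0 := by
  have h1 := untopD_mul v hz (inv_ne_zero hz)
  rw [mul_inv_cancel₀ hz, AddValuation.map_one] at h1
  have h2 : (0 : ℝ) = (v z).untopD 0 + (v z⁻¹).untopD 0 := h1
  rw [hv.mem_iff (inv_ne_zero hz), not_le]
  constructor <;> intro <;> linarith

theorem IsAssociated.eventually_mul_ord_lt (hv : IsAssociated v V)
    (hreg : ∀ n, IsRegularLocalRing (R n).toSubring)
    (hstep : ∀ n, IsStep (R n) (R (n + 1)) (x n))
    (hV : ∀ z, z ∈ V ↔ ∃ n, z ∈ (R n).toSubring) {f g : K} (hf : f ∈ (R 0).toSubring)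
    (hg : g ∈ (R 0).toSubring) (hf0 : f ≠ 0) (hg0 : g ≠ 0) {p d : ℕ}
    (hlt : p * (v g).untopD 0 < d * (v f).untopD 0) :
    ∀ᶠ n in atTop, p * ord (R n) g < d * ord (R n) f := by
  have hmono := monotone_of_isStep hstep
  -- Positive value makes `y` a nonunit of `V`, hence of every `R n` that contains it, so `ord y ≥
  -- 1` there.
  set y : K := f ^ d / g ^ p with hy
  have hfd := pow_ne_zero d hf0
  have hgp := pow_ne_zero p hg0
  have hy0 : y ≠ 0 := div_ne_zero hfd hgp
  have hmul : g ^ p * y = f ^ d := mul_div_cancel₀ _ hgp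
  have hypos : 0 < (v y).untopD 0 := by
    have := untopD_mul v hgp hy0
    rw [hmul, untopD_pow v hf0, untopD_pow v hg0] at this
    linarith
  obtain ⟨N, hN⟩ := (hV y).mp ((hv.mem_iff hy0).mpr hypos.le)
  have hyinv := (hv.pos_iff hy0).mpr hypos
  filter_upwards [eventually_ge_atTop N] with n hn
  have hyn : y ∈ (R n).toSubring := (hmono hn).1 hN
  have hfn : f ∈ (R n).toSubring := (hmono n.zero_le).1 hf
  have hgn : g ∈ (R n).toSubring := (hmono n.zero_le).1 hg
  have h1 : ord (R n) y ≠ 0 := fun h => hyinv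
    ((hV _).mpr ⟨n, (ord_eq_zero_iff hyn hy0).mp h⟩)
  have hA := (hstep n).exists_mem
  have h2 := ord_mul hA (pow_mem hgn p) hgp hyn hy0
  rw [hmul, ord_pow hA hfn hf0, ord_pow hA hgn hg0] at h2
  omega

theorem IsAssociated.tendsto_ord_div_ord (hv : IsAssociated v V)
    (hreg : ∀ n, IsRegularLocalRing (R n).toSubring)
    (hstep : ∀ n, IsStep (R n) (R (n + 1)) (x n))
    (hV : ∀ z, z ∈ V ↔ ∃ n, z ∈ (R n).toSubring) {f g : K} (hf : MemPow (R 0) 1 f)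
    (hg : MemPow (R 0) 1 g) (hf0 : f ≠ 0) (hg0 : g ≠ 0) :
    Tendsto (fun n => (ord (R n) f : ℝ) / (ord (R n) g : ℝ)) atTop
      (𝓝 ((v f).untopD 0 / (v g).untopD 0)) := by
  have hmono := monotone_of_isStep hstep
  have hpos {h : K} (hh : MemPow (R 0) 1 h) (hh0 : h ≠ 0) : 0 < (v h).untopD 0 := by
    rw [← hv.pos_iff hh0, hV]
    rintro ⟨n, hn⟩
    have h1 := hh.of_le (hmono n.zero_le)
    exact ((memPow_one_iff h1.mem).mp h1).elim hh0 fun h => h hn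
  have hα := hpos hf hf0
  have hβ := hpos hg hg0
  have hgord (n) : (0 : ℝ) < ord (R n) g := by
    have h1 := hg.of_le (hmono n.zero_le)
    exact_mod_cast (le_ord_iff h1.mem hg0).mpr h1
  set α := (v f).untopD 0
  set β := (v g).untopD 0
  have hfrac (q : ℚ) (hq : 0 < q) : ∃ p d : ℕ, (0 : ℝ) < d ∧ (q : ℝ) = p / d := by
    refine ⟨q.num.toNat, q.den, by exact_mod_cast q.pos, ?_⟩
    have h1 : ((q.num.toNat : ℤ) : ℚ) = q.num := by
      rw [Int.toNat_of_nonneg (Rat.num_pos.mpr hq).le]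
    have h2 : q = (q.num.toNat : ℚ) / q.den := by
      rw [← Int.cast_natCast, h1, Rat.num_div_den]
    have h3 := congrArg (fun t : ℚ => (t : ℝ)) h2
    simpa only [Rat.cast_div, Rat.cast_natCast] using h3
  refine tendsto_order.mpr ⟨fun a ha => ?_, fun a ha => ?_⟩
  -- Taking the maximum with `0` keeps `q` positive, so that its numerator is a natural number.
  · obtain ⟨q, hq1, hq2⟩ := exists_rat_btwn (max_lt ha (div_pos hα hβ))
    have hq : 0 < q := by exact_mod_cast (le_max_right a 0).trans_lt hq1
    obtain ⟨p, d, hd, hpd⟩ := hfrac q hq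
    have hlt : p * β < d * α := by
      rw [hpd, div_lt_div_iff₀ hd hβ] at hq2
      linarith
    filter_upwards [hv.eventually_mul_ord_lt hreg hstep hV hf.mem hg.mem hf0 hg0 hlt] with n hn
    refine ((le_max_left a 0).trans_lt hq1).trans ?_
    rw [hpd, div_lt_div_iff₀ hd (hgord n), mul_comm (ord (R n) f : ℝ)]
    exact_mod_cast hn
  · obtain ⟨q, hq1, hq2⟩ := exists_rat_btwn ha
    have hq : 0 < q := by exact_mod_cast (div_pos hα hβ).trans hq1
    obtain ⟨p, d, hd, hpd⟩ := hfrac q hq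
    have hlt : d * α < p * β := by
      rw [hpd, div_lt_div_iff₀ hβ hd] at hq1
      linarith
    filter_upwards [hv.eventually_mul_ord_lt hreg hstep hV hg.mem hf.mem hg0 hf0 hlt] with n hn
    refine lt_trans ?_ hq2
    rw [hpd, div_lt_div_iff₀ (hgord n) hd, mul_comm (ord (R n) f : ℝ)]
    exact_mod_cast hn

theorem ringKrullDim_eq_one (hreg : ∀ n, IsRegularLocalRing (R n).toSubring)
    (hstep : ∀ n, IsStep (R n) (R (n + 1)) (x n)) (hR : SwitchesStronglyInfinitelyOften R)
    (hV : ∀ z, z ∈ V ↔ ∃ n, z ∈ (R n).toSubring) : ringKrullDim V = 1 := by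
  have hmono := monotone_of_isStep hstep
  rw [ringKrullDim_eq_one_iff_of_isLocalRing_isDomain]
  constructor
  · intro hfield
    have hxV : x 0 ∈ V := (hV _).mpr ⟨0, (hstep 0).mem⟩
    obtain ⟨c, hc⟩ := hfield.mul_inv_cancel (a := (⟨x 0, hxV⟩ : V))
      fun h => (hstep 0).ne_zero (congrArg Subtype.val h)
    have hc' : x 0 * (c : K) = 1 := congrArg Subtype.val hc
    obtain ⟨n, hn⟩ := (hV _).mp c.2
    have h1 := (hstep 0).memPow.of_le (hmono n.zero_le)
    refine ((memPow_one_iff h1.mem).mp h1).elim (hstep 0).ne_zero fun h => h ?_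
    rw [← eq_inv_of_mul_eq_one_right hc']
    exact hn
  · intro b hb0 y hy
    obtain ⟨i, hi⟩ := (hV _).mp b.2
    obtain ⟨j, hj⟩ := (hV _).mp y.2
    have hbn : (b : K) ∈ (R (max i j)).toSubring := (hmono (le_max_left i j)).1 hi
    have hyn : (y : K) ∈ (R (max i j)).toSubring := (hmono (le_max_right i j)).1 hj
    have hb0' : (b : K) ≠ 0 := by simpa using hb0
    have hy1 : MemPow (R (max i j)) 1 (y : K) := by
      rw [memPow_one_iff hyn]
      by_contra! hc
      refine (mem_maximalIdeal _).mp hy (.of_mul_eq_one ⟨(y : K)⁻¹, (hV _).mpr ⟨_, hc.2⟩⟩ ?_)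
      exact Subtype.ext (mul_inv_cancel₀ hc.1)
    obtain ⟨k, c, hc, hk⟩ := (hR.eventuallyUnit hreg hstep hbn hb0').exists_pow_eq_mul hstep
      (V := V.toSubring) (fun n z hz => (hV z).mpr ⟨n, hz⟩) hy1
    refine ⟨k, Ideal.mem_span_singleton'.mpr ⟨⟨c, hc⟩, Subtype.ext ?_⟩⟩
    change c * (b : K) = (y : K) ^ k
    rw [hk, mul_comm]

/-- In dimension one, the nonunit `a⁻¹` has a power in the nonzero ideal generated by `b⁻¹` (when `b
∉ V`). -/
theorem exists_div_pow_mem_of_ringKrullDim_eq_one {V : ValuationSubring K}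
    (hV : ringKrullDim V = 1) {a : K} (ha : a ∉ V) (b : K) : ∃ n : ℕ, b / a ^ n ∈ V := by
  by_cases hb : b ∈ V
  · exact ⟨0, by simpa using hb⟩
  have ha' := (V.mem_or_inv_mem a).resolve_left ha
  have hb' := (V.mem_or_inv_mem b).resolve_left hb
  have hb0 : b ≠ 0 := fun h => hb (h ▸ zero_mem V)
  have hmax : (⟨a⁻¹, ha'⟩ : V) ∈ maximalIdeal V := by
    rw [mem_maximalIdeal]
    intro hu
    obtain ⟨c, hc⟩ := hu.exists_right_inv
    have : a⁻¹ * (c : K) = 1 := congrArg Subtype.val hc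
    have h2 := eq_inv_of_mul_eq_one_right this
    rw [inv_inv] at h2
    exact ha (h2 ▸ c.2)
  obtain ⟨n, hn⟩ := (ringKrullDim_eq_one_iff_of_isLocalRing_isDomain.mp hV).2
    (⟨b⁻¹, hb'⟩ : V) (fun h => inv_ne_zero hb0 (congrArg Subtype.val h)) hmax
  obtain ⟨c, hc⟩ := Ideal.mem_span_singleton'.mp hn
  have hc' : (c : K) * b⁻¹ = a⁻¹ ^ n := congrArg Subtype.val hc
  refine ⟨n, ?_⟩
  rw [div_eq_mul_inv, ← inv_pow, ← hc', mul_left_comm, mul_inv_cancel₀ hb0, mul_one]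
  exact c.2

end Union
end QuadraticTransform

theorem mainTheorem8 {K : Type*} [Field K] (R : ℕ → LocalSubring K)
    [IsRegularLocalRing (R 0).toSubring] [IsFractionRing (R 0).toSubring K]
    (hR : ∀ n, QuadraticTransform.IsLocalQuadraticTransform (R n) (R (n + 1)))
    (hswitch : QuadraticTransform.SwitchesStronglyInfinitelyOften R) :
    ∃ V : ValuationSubring K,
      (V : Set K) = ⋃ n, ((R n).toSubring : Set K) ∧
      ringKrullDim V = 1 ∧
      (∃ v : AddValuation K (WithTop ℝ), QuadraticTransform.IsAssociated v V) ∧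
      ∀ v : AddValuation K (WithTop ℝ), QuadraticTransform.IsAssociated v V →
        ∀ f ∈ maximalIdeal (R 0).toSubring, ∀ g ∈ maximalIdeal (R 0).toSubring,
          f ≠ 0 → g ≠ 0 →
          Tendsto (fun n => (QuadraticTransform.ord (R n) (f : K) : ℝ) /
              (QuadraticTransform.ord (R n) (g : K) : ℝ)) atTop
            (𝓝 ((v (f : K)).untopD 0 / (v (g : K)).untopD 0)) := by
  open QuadraticTransform in
  have hreg : ∀ n, IsRegularLocalRing (R n).toSubring := by
    intro n
    induction n with
    | zero => assumption
    | succ n ih => exact (hR n).isRegularLocalRing_and_exists_isStep.1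
  choose x hstep using fun n =>
    have := hreg n
    (hR n).isRegularLocalRing_and_exists_isStep.2
  have hdir : Directed (· ≤ ·) fun n => (R n).toSubring :=
    (LocalSubring.toSubring_mono.comp (monotone_of_isStep hstep)).directed_le
  have hmem (z : K) : z ∈ (⨆ n, (R n).toSubring) ↔ ∃ n, z ∈ (R n).toSubring :=
    Subring.mem_iSup_of_directed hdir
  let V : ValuationSubring K :=
    { (⨆ n, (R n).toSubring : Subring K) with
      mem_or_inv_mem' := fun z => by
        obtain ⟨n, h | h⟩ := exists_mem_or_inv_mem hreg hstep hswitch z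
        · exact Or.inl ((hmem z).mpr ⟨n, h⟩)
        · exact Or.inr ((hmem _).mpr ⟨n, h⟩) }
  have hV (z : K) : z ∈ V ↔ ∃ n, z ∈ (R n).toSubring := hmem z
  have hdim : ringKrullDim V = 1 := ringKrullDim_eq_one hreg hstep hswitch hV
  refine ⟨V, ?_, hdim,
    exists_isAssociated fun a ha b => exists_div_pow_mem_of_ringKrullDim_eq_one hdim ha b, ?_⟩
  · ext z
    rw [Set.mem_iUnion]
    exact hV z
  · intro v hv f hf g hg hf0 hg0
    exact hv.tendsto_ord_div_ord hreg hstep hV ⟨f, by simpa using hf, rfl⟩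
      ⟨g, by simpa using hg, rfl⟩ (by simpa using hf0) (by simpa using hg0)
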